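/- Throughout, $\mathrm{sinc}(s)=\sin(\pi s)/(\pi s)$, $\mathrm{sinc}(0)=1$, and mutual informations are in bits. Let $T>0$, $\tau,\gamma\in\mathbb R$, $P\ge 0$, $N>0$, and let $\nu$ be a probability law on $\mathbb C$ with $\int|u|^2\,d\nu=1$. Two satellites transmit the same signal $x(t)=\sum_{i=0}^{n-1}x_i\,\mathrm{sinc}((t-iT)/T)$, where $x_i=\sqrt P\,u_i$ and the $u_i$ are i.i.d. of law $\nu$. The second signal is received with gain $\gamma$, delay $\tau$ and slowly varying phase, so that the samples at the times $kT$ are $$y_k=x(kT)+\gamma e^{j\phi_k}x(kT-\tau)+w_k,\qquad 0\le k<n,$$ with $w_k$ i.i.d. circularly symmetric complex Gaussian of variance $N$. The phase process $(\phi_k)_{k\ge0}$ is independent of symbols and noise and known to the receiver; $(e^{j\phi_k})_k$ is stationary and ergodic, and $\mathrm E[\cos\phi_0]=0$ (for instance $\phi_0$ uniform on $[0,2\pi)$). Let $\boldsymbol x=(x_0,\dots,x_{n-1})$, $\boldsymbol y=(y_0,\dots,y_{n-1})$, let $I(\boldsymbol x;\boldsymbol y\,|\,\phi)$ be their mutual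 information for a given realization $\phi$ of the phases, and let $I(\rho)$ be the mutual information between $u\sim\nu$ and $\sqrt\rho\,u+w$, where $w$ is independent circularly symmetric complex Gaussian noise of variance $1$. Then: 1. The channel is time-varying and frequency-selective: for every realization of the phases, $y_k=\sum_{i=0}^{n-1}h_{k,k-i}x_i+w_k$, with $h_{k,m}=\gamma e^{j\phi_k}\mathrm{sinc}(m-\tau/T)$ for $m\ne0$ and $h_{k,0}=1+\gamma e^{j\phi_k}\mathrm{sinc}(-\tau/T)$. 2. For almost every realization $\phi$ of the phases, $$\limsup_{n\to\infty}\frac{I(\boldsymbol x;\boldsymbol y\,|\,\phi)}n\le I\Big((1+\gamma^2)\frac PN\Big).$$ 3. The ergodic rate obeys the same bound: $$\limsup_{n\to\infty}\frac{\mathrm E_\phi[I(\boldsymbol x;\boldsymbol y\,|\,\phi)]}n\le I\Big((1+\gamma^2)\frac PN\Big).$$ 4. For every phase $\theta$, $I((1+\gamma^2)P/N)$ is the rate per channel use of the Alamouti scheme with the same input distribution: it equals $\frac12 I(x_1,x_2;y_a,y_b)$, where $y_a=x_1+\gamma e^{j\theta}x_2+w_a$, $y_b=x_2^*-\gamma e^{j\theta}x_1^*+w_b$,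 $x_i=\sqrt P u_i$ with $u_1,u_2$ i.i.d. of law $\nu$, and $w_a,w_b$ are independent noise of variance $N$. 5. If $\nu$ is invariant under $u\mapsto-u$, then $I((1+\gamma^2)P/N)\le I(x_1,x_2;\,x_1+\gamma x_2+w)$, the rate with independent signals $x_1,x_2$ as in 4 and noise $w$ of variance $N$. 6. If $\nu$ is circularly symmetric complex Gaussian, then for every $\theta$ the rate with independent signals is $$I(x_1,x_2;\,x_1+\gamma e^{j\theta}x_2+w)=I\Big((1+\gamma^2)\frac PN\Big)=\log_2\Big(1+(1+\gamma^2)\frac PN\Big).$$ -/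

import Mathlib

open MeasureTheory ProbabilityTheory Filter
open scoped ENNReal NNReal

noncomputable section

/-- Mutual information `I(X; Y)`, in bits, of two random variables on `(Ω, P)`: the
Kullback-Leibler divergence of the joint law from the product of the marginals. -/
def mutualInfoBits {Ω α β : Type*} [MeasurableSpace Ω] [MeasurableSpace α] [MeasurableSpace β]
    (P : Measure Ω) (X : Ω → α) (Y : Ω → β) : ℝ≥0∞ :=
  InformationTheory.klDiv (P.map fun ω => (X ω, Y ω)) ((P.map X).prod (P.map Y))
    / ENNReal.ofReal (Real.log 2)

/-- The circularly symmetric complex Gaussian law of mean `0` and total variance `v`. -/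
def complexGaussian (v : ℝ≥0) : Measure ℂ :=
  ((gaussianReal 0 (v / 2)).prod (gaussianReal 0 (v / 2))).map
    fun p => (p.1 : ℂ) + (p.2 : ℂ) * Complex.I

/-- The rate, in bits, of the scalar channel `y = √ρ u + w` at signal-to-noise ratio `ρ`, where
`u` has law `ν` (of unit power) and the noise `w` is complex Gaussian of variance `1`. -/
def scalarRate (ν : Measure ℂ) (ρ : ℝ≥0) : ℝ≥0∞ :=
  mutualInfoBits (ν.prod (complexGaussian 1)) (fun p => p.1)
    (fun p => (Real.sqrt ρ : ℂ) * p.1 + p.2)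

/-- The shaping pulse `p(t) = sinc(t / T)`, with `sinc(s) = sin(π s) / (π s)`. -/
def shapingPulse (T t : ℝ) : ℝ := Real.sinc (Real.pi * (t / T))

/-- The signal `x(t) = ∑ i, x_i p(t - i T)` carrying the block `x_0, …, x_{n-1}`. -/
def waveform (T : ℝ) {n : ℕ} (x : Fin n → ℂ) (t : ℝ) : ℂ :=
  ∑ i : Fin n, x i * (shapingPulse T (t - (i : ℝ) * T) : ℂ)

/-- The noiseless received sample at time `k T` when both satellites transmit the same signal,
`x(t) + γ e^{jφ(t)} x(t - τ)`; here `φ k` is the phase at time `k T`. -/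
def sameSignalSample (T τ γ : ℝ) (φ : ℕ → ℝ) {n : ℕ} (x : Fin n → ℂ) (k : ℕ) : ℂ :=
  waveform T x ((k : ℝ) * T)
    + (γ : ℂ) * Complex.exp ((φ k : ℂ) * Complex.I) * waveform T x ((k : ℝ) * T - τ)

/-- The time-varying impulse response `h_{k,m}`: `γ e^{jφ_k} sinc(m - τ/T)`, plus `1` if `m = 0`. -/
def impulseResponse (T τ γ : ℝ) (φ : ℕ → ℝ) (k : ℕ) (m : ℤ) : ℂ :=
  (if m = 0 then 1 else 0)
    + (γ : ℂ) * Complex.exp ((φ k : ℂ) * Complex.I)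
      * (Real.sinc (Real.pi * ((m : ℝ) - τ / T)) : ℂ)

/-- The mutual information `I(x; y)`, in bits, between the transmitted block `x_k = √P u_k`, `k < n`,
with `u_k` independent of law `ν`, and the received block `y_k` observed in independent complex
Gaussian noise of variance `N`, for the given realization `φ` of the phases (which the receiver
knows). -/
def sameSignalInfo (T τ γ : ℝ) (P N : ℝ≥0) (ν : Measure ℂ) (φ : ℕ → ℝ) (n : ℕ) : ℝ≥0∞ :=
  mutualInfoBits
    ((Measure.pi fun _ : Fin n => ν).prod (Measure.pi fun _ : Fin n => complexGaussian N))
    (fun p (k : Fin n) => (Real.sqrt P : ℂ) * p.1 k)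
    (fun p (k : Fin n) =>
      sameSignalSample T τ γ φ (fun i => (Real.sqrt P : ℂ) * p.1 i) (k : ℕ) + p.2 k)

/-- The sum rate `I(x₁, x₂; y)`, in bits, of the channel `y = x₁ + γ e^{jθ} x₂ + w` with independent
signals `x_i = √P u_i`, `u_i` of law `ν`, and complex Gaussian noise of variance `N`. -/
def independentRate (γ θ : ℝ) (P N : ℝ≥0) (ν : Measure ℂ) : ℝ≥0∞ :=
  mutualInfoBits ((ν.prod ν).prod (complexGaussian N))
    (fun p => ((Real.sqrt P : ℂ) * p.1.1, (Real.sqrt P : ℂ) * p.1.2))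
    (fun p => (Real.sqrt P : ℂ) * p.1.1
      + (γ : ℂ) * Complex.exp ((θ : ℂ) * Complex.I) * ((Real.sqrt P : ℂ) * p.1.2) + p.2)

/-- The rate per channel use, in bits, of the Alamouti scheme: the satellites transmit `x₁, x₂`
and then `x₂*, -x₁*`, with `x_i = √P u_i`, the `u_i` independent of law `ν`, over the channel of
relative gain `γ e^{jθ}` and complex Gaussian noise of variance `N`. -/
def alamoutiRate (γ θ : ℝ) (P N : ℝ≥0) (ν : Measure ℂ) : ℝ≥0∞ :=
  mutualInfoBits
    ((ν.prod ν).prod ((complexGaussian N).prod (complexGaussian N)))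
    (fun p => ((Real.sqrt P : ℂ) * p.1.1, (Real.sqrt P : ℂ) * p.1.2))
    (fun p =>
      ((Real.sqrt P : ℂ) * p.1.1
          + (γ : ℂ) * Complex.exp ((θ : ℂ) * Complex.I) * ((Real.sqrt P : ℂ) * p.1.2) + p.2.1,
        starRingEnd ℂ ((Real.sqrt P : ℂ) * p.1.2)
          + (γ : ℂ) * Complex.exp ((θ : ℂ) * Complex.I)
            * (-(starRingEnd ℂ ((Real.sqrt P : ℂ) * p.1.1))) + p.2.2)) / 2

/-- A complex-valued random sequence is stationary and ergodic: the shift preserves its law on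
sequence space and is ergodic for it. -/
def IsStationaryErgodic {Ω : Type*} [MeasurableSpace Ω] (μ : Measure Ω) (Z : ℕ → Ω → ℂ) : Prop :=
  Ergodic (fun (s : ℕ → ℂ) (k : ℕ) => s (k + 1)) (μ.map fun ω k => Z k ω)

end

/-!
Decoding symbols one after another shows that the information of a sum of independent signals in
additive noise is at most the sum of the informations which each signal alone would carry. So a
block of symbols carries at most the sum over `i` of the information of `u_i` received alone, and by
rotation invariance of the noise this is a scalar channel whose signal-to-noise ratio is `P / N`
times the energy of the signature of symbol `i`. Bessel's inequality for the orthonormal integer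
shifts of the cardinal sine bounds that energy by `1 + γ² + 2 γ sinc(τ / T) cos φ_i`.

The scalar information, as a function of the signal-to-noise ratio `ρ`, is `ρ - D(ρ)`, where `D(ρ)`
is the divergence of the output from the noise; `D` is convex because the divergence from the noise
is supermodular in independent signals. A supporting line at `(1 + γ²) P / N` therefore bounds the
rate by its value there plus a multiple of the average of `cos φ_i`, which tends to `0` by the
ergodic theorem.

The Alamouti signal map is `√(1 + γ²)` times an isometry, so its channel splits into two scalar
channels, while each of its two outputs, observed alone, is a superposition channel.
-/

open InformationTheory

/-! ### Kullback-Leibler divergence -/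

section KullbackLeibler

variable {X Y Z : Type*} [MeasurableSpace X] [MeasurableSpace Y] [MeasurableSpace Z]

lemma klDiv_map_of_leftInverse (μ ν : Measure X) [IsFiniteMeasure μ] [IsFiniteMeasure ν]
    {f : X → Y} {g : Y → X} (hf : Measurable f) (hg : Measurable g)
    (hgf : Function.LeftInverse g f) : klDiv (μ.map f) (ν.map f) = klDiv μ ν := by
  refine le_antisymm (klDiv_map_le μ ν hf) ?_
  have h := klDiv_map_le (μ.map f) (ν.map f) hg
  rwa [Measure.map_map hg hf, Measure.map_map hg hf, hgf.comp_eq_id, Measure.map_id,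
    Measure.map_id] at h

lemma klDiv_prod_left (ρ : Measure X) [IsProbabilityMeasure ρ] (μ ν : Measure Y)
    [IsProbabilityMeasure μ] [IsProbabilityMeasure ν] :
    klDiv (ρ.prod μ) (ρ.prod ν) = klDiv μ ν := by
  rw [← klDiv_map_of_leftInverse _ _ measurable_swap measurable_swap Prod.swap_leftInverse,
    Measure.prod_swap, Measure.prod_swap, ← Measure.compProd_const, ← Measure.compProd_const,
    klDiv_compProd_left]

lemma klDiv_prod_eq_fst_add [StandardBorelSpace Y] [Nonempty Y] (μ : Measure (X × Y))
    [IsProbabilityMeasure μ] (ρ : Measure X) [IsFiniteMeasure ρ] (η : Measure Y)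
    [IsProbabilityMeasure η] :
    klDiv μ (ρ.prod η) = klDiv μ.fst ρ + klDiv μ (μ.fst.prod η) := by
  have h := klDiv_compProd_eq_add μ.fst ρ μ.condKernel (Kernel.const X η)
  rwa [μ.disintegrate μ.condKernel, Measure.compProd_const, Measure.compProd_const] at h

lemma klDiv_prod_eq_snd_add [StandardBorelSpace X] [Nonempty X] (μ : Measure (X × Y))
    [IsProbabilityMeasure μ] (ρ : Measure X) [IsProbabilityMeasure ρ] (η : Measure Y)
    [IsFiniteMeasure η] :
    klDiv μ (ρ.prod η) = klDiv μ.snd η + klDiv μ (ρ.prod μ.snd) := by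
  have : IsProbabilityMeasure (μ.map Prod.swap) :=
    Measure.isProbabilityMeasure_map measurable_swap.aemeasurable
  have h := klDiv_prod_eq_fst_add (μ.map Prod.swap) η ρ
  rwa [Measure.fst_map_swap, ← Measure.prod_swap, ← Measure.prod_swap (ν := μ.snd),
    klDiv_map_of_leftInverse _ _ measurable_swap measurable_swap Prod.swap_leftInverse,
    klDiv_map_of_leftInverse _ _ measurable_swap measurable_swap Prod.swap_leftInverse] at h

lemma klDiv_prod_prod [StandardBorelSpace Y] [Nonempty Y] (μ₁ ν₁ : Measure X) (μ₂ ν₂ : Measure Y)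
    [IsProbabilityMeasure μ₁] [IsProbabilityMeasure ν₁] [IsProbabilityMeasure μ₂]
    [IsProbabilityMeasure ν₂] :
    klDiv (μ₁.prod μ₂) (ν₁.prod ν₂) = klDiv μ₁ ν₁ + klDiv μ₂ ν₂ := by
  rw [klDiv_prod_eq_fst_add, Measure.fst_prod, klDiv_prod_left]

/-- Given the first coordinate, the third one is at least as far from independence together with
the second one as it is alone. -/
lemma klDiv_supermodular [StandardBorelSpace Z] [Nonempty Z] (μ : Measure ((X × Y) × Z))
    [IsProbabilityMeasure μ] (α : Measure X) (β : Measure Y) (ζ : Measure Z)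
    [IsProbabilityMeasure α] [IsProbabilityMeasure β] [IsProbabilityMeasure ζ] :
    klDiv μ.fst (α.prod β) + klDiv (μ.map (Prod.map Prod.fst id)) (α.prod ζ)
      ≤ klDiv μ ((α.prod β).prod ζ) + klDiv μ.fst.fst α := by
  have hfst : Measurable (Prod.map Prod.fst id : (X × Y) × Z → X × Z) := by fun_prop
  have : IsProbabilityMeasure (μ.map (Prod.map Prod.fst id : (X × Y) × Z → X × Z)) :=
    Measure.isProbabilityMeasure_map hfst.aemeasurable
  have hmarg : (μ.map (Prod.map Prod.fst id : (X × Y) × Z → X × Z)).fst = μ.fst.fst := by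
    simp only [Measure.fst, Measure.map_map measurable_fst hfst,
      Measure.map_map measurable_fst measurable_fst]
    rfl
  have hdrop : klDiv (μ.map (Prod.map Prod.fst id)) (μ.fst.fst.prod ζ)
      ≤ klDiv μ (μ.fst.prod ζ) := by
    have h := klDiv_map_le μ (μ.fst.prod ζ) hfst
    rwa [← Measure.map_prod_map _ _ measurable_fst measurable_id, Measure.map_id] at h
  rw [klDiv_prod_eq_fst_add μ, klDiv_prod_eq_fst_add (μ.map _), hmarg, add_assoc,
    add_comm (klDiv μ.fst.fst α)]
  gcongr

end KullbackLeibler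

/-! ### Information in additive noise -/

section SufficientStatistic

variable {X S W Y : Type*} [MeasurableSpace X] [MeasurableSpace S] [MeasurableSpace W]
  [MeasurableSpace Y] [StandardBorelSpace X] [Nonempty X]

lemma map_prod_compProd_condDistrib (π : Measure X) [IsProbabilityMeasure π] (η : Measure W)
    [IsProbabilityMeasure η] {f : X → S} (hf : Measurable f) {g : S × W → Y} (hg : Measurable g) :
    (((π.map f).prod η).map fun p => (p.1, g p)) ⊗ₘ (condDistrib id f π).prodMkRight Y
      = (π.prod η).map fun p => ((f p.1, g (f p.1, p.2)), p.1) := by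
  have : IsProbabilityMeasure (π.map f) := Measure.isProbabilityMeasure_map hf.aemeasurable
  have hfg : Measurable fun p : X × W => ((f p.1, g (f p.1, p.2)), p.1) := by fun_prop
  refine Measure.ext_of_lintegral _ fun F hF => ?_
  calc ∫⁻ q, F q ∂((((π.map f).prod η).map fun p => (p.1, g p))
        ⊗ₘ (condDistrib id f π).prodMkRight Y)
    _ = ∫⁻ s, ∫⁻ w, ∫⁻ x, F ((s, g (s, w)), x) ∂condDistrib id f π s ∂η ∂(π.map f) := by
      have hin := hF.lintegral_kernel_prod_right' (κ := (condDistrib id f π).prodMkRight Y)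
      have hout : Measurable fun p : S × W => (p.1, g p) := by fun_prop
      rw [Measure.lintegral_compProd hF, lintegral_map hin hout, lintegral_prod]
      exacts [rfl, (hin.comp hout).aemeasurable]
    _ = ∫⁻ s, ∫⁻ x, ∫⁻ w, F ((s, g (s, w)), x) ∂η ∂condDistrib id f π s ∂(π.map f) :=
      lintegral_congr fun s => lintegral_lintegral_swap (by fun_prop)
    _ = ∫⁻ q, ∫⁻ w, F ((q.1, g (q.1, w)), q.2) ∂η ∂(π.map fun x => (f x, id x)) := by
      rw [← compProd_map_condDistrib (X := f) (Y := id) aemeasurable_id,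
        Measure.lintegral_compProd (by fun_prop)]
    _ = ∫⁻ q, F q ∂((π.prod η).map fun p => ((f p.1, g (f p.1, p.2)), p.1)) := by
      rw [lintegral_map (by fun_prop) (by fun_prop), lintegral_map hF hfg,
        lintegral_prod _ (by fun_prop)]
      rfl

/-- The input enters the channel only through the statistic `f`. -/
lemma klDiv_map_statistic (π : Measure X) [IsProbabilityMeasure π] (η : Measure W)
    [IsProbabilityMeasure η] (Q : Measure Y) [IsProbabilityMeasure Q] {f : X → S}
    (hf : Measurable f) {g : S × W → Y} (hg : Measurable g) :
    klDiv ((π.prod η).map fun p => (p.1, g (f p.1, p.2))) (π.prod Q)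
      = klDiv (((π.map f).prod η).map fun p => (p.1, g p)) ((π.map f).prod Q) := by
  have : IsProbabilityMeasure (π.map f) := Measure.isProbabilityMeasure_map hf.aemeasurable
  have hgf : Measurable fun p : X × W => (p.1, g (f p.1, p.2)) := by fun_prop
  have hfst : Measurable fun p : S × W => (p.1, g p) := by fun_prop
  have hlift : Measurable fun q : X × Y => ((f q.1, q.2), q.1) := by fun_prop
  have := Measure.isProbabilityMeasure_map (μ := (π.map f).prod η) hfst.aemeasurable
  have := Measure.isProbabilityMeasure_map (μ := π.prod η) hgf.aemeasurable
  have hQ := map_prod_compProd_condDistrib π Q hf (measurable_snd (α := S) (β := Y))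
  rw [show (fun p : S × Y => (p.1, p.2)) = id from rfl, Measure.map_id] at hQ
  rw [← klDiv_map_of_leftInverse _ _ hlift (measurable_snd.prodMk (measurable_snd.comp
    measurable_fst)) (fun _ => rfl), Measure.map_map hlift hgf, ← hQ,
    ← klDiv_compProd_left _ _ ((condDistrib id f π).prodMkRight Y),
    map_prod_compProd_condDistrib π η hf hg]
  rfl

end SufficientStatistic

section AdditiveNoise

variable {E F : Type*} [AddCommGroup E] [MeasurableSpace E] [AddCommGroup F] [MeasurableSpace F]

/-- The joint law of the signal and of the output of the channel which adds independent noise of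
law `γ` to a signal of law `σ`. -/
noncomputable def signalOutputLaw (σ γ : Measure E) : Measure (E × E) :=
  (σ.prod γ).map fun p => (p.1, p.1 + p.2)

/-- The mutual information, in nats, between a signal of law `σ` and its sum with independent noise
of law `γ`; the output has law `σ ∗ γ`. -/
noncomputable def additiveNoiseInfo (σ γ : Measure E) : ℝ≥0∞ :=
  klDiv (signalOutputLaw σ γ) (σ.prod (σ ∗ γ))

variable [MeasurableAdd₂ E] [MeasurableAdd₂ F] (σ γ : Measure E)

lemma snd_signalOutputLaw : (signalOutputLaw σ γ).snd = σ ∗ γ := by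
  rw [signalOutputLaw, Measure.snd, Measure.map_map measurable_snd (by fun_prop)]
  rfl

variable [IsProbabilityMeasure σ] [IsProbabilityMeasure γ]

instance isProbabilityMeasure_signalOutputLaw : IsProbabilityMeasure (signalOutputLaw σ γ) :=
  Measure.isProbabilityMeasure_map (by fun_prop)

lemma additiveNoiseInfo_dirac_zero : additiveNoiseInfo (Measure.dirac 0) γ = 0 := by
  rw [additiveNoiseInfo, signalOutputLaw, Measure.dirac_zero_conv, Measure.dirac_prod,
    Measure.map_map (by fun_prop) (by fun_prop)]
  convert klDiv_self _ using 3
  · ext x <;> simp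
  · infer_instance

/-- The output law is the product reference closest to the joint law. -/
lemma additiveNoiseInfo_add_klDiv_conv [StandardBorelSpace E] (η : Measure E)
    [IsFiniteMeasure η] :
    additiveNoiseInfo σ γ + klDiv (σ ∗ γ) η = klDiv (signalOutputLaw σ γ) (σ.prod η) := by
  rw [klDiv_prod_eq_snd_add, snd_signalOutputLaw, add_comm, additiveNoiseInfo]

lemma signalOutputLaw_map {e : E →+ F} (he : Measurable e) :
    signalOutputLaw (σ.map e) (γ.map e) = (signalOutputLaw σ γ).map (Prod.map e e) := by
  rw [signalOutputLaw, signalOutputLaw, Measure.map_prod_map _ _ he he,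
    Measure.map_map (by fun_prop) (by fun_prop), Measure.map_map (by fun_prop) (by fun_prop)]
  congr 1
  ext p <;> simp

lemma additiveNoiseInfo_map {e : E →+ F} (he : Measurable e) {d : F → E} (hd : Measurable d)
    (hde : Function.LeftInverse d e) :
    additiveNoiseInfo (σ.map e) (γ.map e) = additiveNoiseInfo σ γ := by
  have := Measure.isProbabilityMeasure_map (μ := σ) he.aemeasurable
  rw [additiveNoiseInfo, signalOutputLaw_map σ γ he, ← Measure.map_conv_addMonoidHom e he,
    Measure.map_prod_map _ _ he he, klDiv_map_of_leftInverse _ _ (he.prodMap he) (hd.prodMap hd)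
    (hde.prodMap hde), additiveNoiseInfo]

end AdditiveNoise

section Products

variable {A B C D : Type*} [MeasurableSpace A] [MeasurableSpace B] [MeasurableSpace C]
  [MeasurableSpace D] (α : Measure A) (β : Measure B) (γ : Measure C) (δ : Measure D) [SFinite α]
  [SFinite β] [SFinite γ] [SFinite δ]

lemma measurePreserving_prod_leftComm :
    MeasurePreserving (fun p : A × B × C => (p.2.1, p.1, p.2.2)) (α.prod (β.prod γ))
      (β.prod (α.prod γ)) :=
  (measurePreserving_prodAssoc β α γ).comp
    ((Measure.measurePreserving_swap.prod (.id γ)).comp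
      ((measurePreserving_prodAssoc α β γ).symm _))

lemma measurePreserving_prodProdProdComm :
    MeasurePreserving (Equiv.prodProdProdComm A B C D) ((α.prod β).prod (γ.prod δ))
      ((α.prod γ).prod (β.prod δ)) :=
  ((measurePreserving_prodAssoc α γ (β.prod δ)).symm _).comp
    (((MeasurePreserving.id α).prod (measurePreserving_prod_leftComm β γ δ)).comp
      (measurePreserving_prodAssoc α β (γ.prod δ)))

variable {E F : Type*} [AddCommGroup E] [MeasurableSpace E] [MeasurableAdd₂ E]
  [AddCommGroup F] [MeasurableSpace F] [MeasurableAdd₂ F]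

instance measurableAdd₂_prod : MeasurableAdd₂ (E × F) where
  measurable_add := by
    change Measurable fun p : (E × F) × E × F => (p.1.1 + p.2.1, p.1.2 + p.2.2)
    fun_prop

variable (σ γ : Measure E) (σ' γ' : Measure F) [IsProbabilityMeasure σ] [IsProbabilityMeasure γ]
  [IsProbabilityMeasure σ'] [IsProbabilityMeasure γ']

lemma signalOutputLaw_prod :
    signalOutputLaw (σ.prod σ') (γ.prod γ')
      = ((signalOutputLaw σ γ).prod (signalOutputLaw σ' γ')).map
          (Equiv.prodProdProdComm E E F F) := by
  have hcomm := measurePreserving_prodProdProdComm σ γ σ' γ'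
  rw [signalOutputLaw, signalOutputLaw, signalOutputLaw,
    Measure.map_prod_map _ _ (by fun_prop) (by fun_prop), ← hcomm.map_eq,
    Measure.map_map (by fun_prop) hcomm.measurable,
    Measure.map_map]
  · rfl
  · exact (measurePreserving_prodProdProdComm σ γ σ' γ').measurable
  · fun_prop

lemma prod_conv_prod : (σ.prod σ') ∗ (γ.prod γ') = (σ ∗ γ).prod (σ' ∗ γ') := by
  have hcomm := measurePreserving_prodProdProdComm σ γ σ' γ'
  rw [Measure.conv, Measure.conv, Measure.conv,
    Measure.map_prod_map _ _ (by fun_prop) (by fun_prop), ← hcomm.map_eq,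
    Measure.map_map (by fun_prop) hcomm.measurable]
  rfl

lemma additiveNoiseInfo_prod [StandardBorelSpace F] :
    additiveNoiseInfo (σ.prod σ') (γ.prod γ')
      = additiveNoiseInfo σ γ + additiveNoiseInfo σ' γ' := by
  have hcomm := measurePreserving_prodProdProdComm σ (σ ∗ γ) σ' (σ' ∗ γ')
  rw [additiveNoiseInfo, signalOutputLaw_prod, prod_conv_prod, ← hcomm.map_eq,
    klDiv_map_of_leftInverse _ _ hcomm.measurable
      (measurePreserving_prodProdProdComm σ σ' γ γ').measurable
      (Equiv.prodProdProdComm E E F F).left_inv, klDiv_prod_prod]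
  rfl

end Products

section Channel

variable {Ω X E : Type*} [MeasurableSpace Ω] [MeasurableSpace X] [StandardBorelSpace X] [Nonempty X]
  [AddCommGroup E] [MeasurableSpace E] [MeasurableAdd₂ E]

lemma map_prod_add_eq_conv (π : Measure Ω) [SFinite π] (γ : Measure E) [SFinite γ] {f : Ω → E}
    (hf : Measurable f) : (π.prod γ).map (fun p => f p.1 + p.2) = π.map f ∗ γ := by
  rw [Measure.conv, ← Measure.map_id (μ := γ), Measure.map_prod_map _ _ hf measurable_id,
    Measure.map_map (by fun_prop) (by fun_prop), Measure.map_id]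
  rfl

lemma klDiv_map_add (π : Measure X) [IsProbabilityMeasure π] (γ Q : Measure E)
    [IsProbabilityMeasure γ] [IsProbabilityMeasure Q] {f : X → E} (hf : Measurable f) :
    klDiv ((π.prod γ).map fun p => (p.1, f p.1 + p.2)) (π.prod Q)
      = klDiv (signalOutputLaw (π.map f) γ) ((π.map f).prod Q) :=
  klDiv_map_statistic π γ Q hf measurable_add

lemma mutualInfoBits_add_noise (π : Measure Ω) [IsProbabilityMeasure π] (γ : Measure E)
    [IsProbabilityMeasure γ] {x : Ω → X} (hx : Measurable x) {f : X → E} (hf : Measurable f) :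
    mutualInfoBits (π.prod γ) (fun p => x p.1) (fun p => f (x p.1) + p.2)
      = additiveNoiseInfo ((π.map x).map f) γ / ENNReal.ofReal (Real.log 2) := by
  have := Measure.isProbabilityMeasure_map (μ := π) hx.aemeasurable
  have := Measure.isProbabilityMeasure_map (μ := π.map x) hf.aemeasurable
  have hjoint : (π.prod γ).map (fun p => (x p.1, f (x p.1) + p.2))
      = ((π.map x).prod γ).map fun p => (p.1, f p.1 + p.2) := by
    rw [← Measure.map_id (μ := γ), Measure.map_prod_map _ _ hx measurable_id,
      Measure.map_map (by fun_prop) (by fun_prop), Measure.map_id]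
    rfl
  have hin : (π.prod γ).map (fun p => x p.1) = π.map x := by
    rw [← Function.comp_def x, ← Measure.map_map hx measurable_fst, ← Measure.fst, Measure.fst_prod]
  have hout : (π.prod γ).map (fun p => f (x p.1) + p.2) = (π.map x).map f ∗ γ := by
    rw [Measure.map_map hf hx, ← map_prod_add_eq_conv π γ (hf.comp hx)]
    rfl
  rw [mutualInfoBits, hjoint, hin, hout, klDiv_map_add _ _ _ hf, additiveNoiseInfo]

end Channel

section SumsOfSignals

variable {E : Type*} [AddCommGroup E] [MeasurableSpace E] [MeasurableAdd₂ E]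
  (σ σ₁ σ₂ γ η : Measure E) [IsProbabilityMeasure σ] [IsProbabilityMeasure σ₁]
  [IsProbabilityMeasure σ₂] [IsProbabilityMeasure γ] [IsProbabilityMeasure η]

lemma additiveNoiseInfo_conv_noise_le :
    additiveNoiseInfo σ (η ∗ γ) ≤ additiveNoiseInfo σ γ := by
  let addNoise : E × E × E → E × E := fun p => (p.2.1, p.1 + p.2.2)
  have hadd : Measurable addNoise := by fun_prop
  have hjoint : (η.prod (signalOutputLaw σ γ)).map addNoise = signalOutputLaw σ (η ∗ γ) := by
    have hcomm := measurePreserving_prod_leftComm σ η γ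
    rw [signalOutputLaw, signalOutputLaw, Measure.conv]
    nth_rw 1 [← Measure.map_id (μ := η)]
    nth_rw 2 [← Measure.map_id (μ := σ)]
    rw [Measure.map_prod_map _ _ measurable_id (by fun_prop),
      Measure.map_prod_map _ _ measurable_id (by fun_prop), ← hcomm.map_eq,
      Measure.map_map (by fun_prop) (by fun_prop), Measure.map_map (by fun_prop) (by fun_prop),
      Measure.map_map (by fun_prop) (by fun_prop)]
    congr 1
    ext p
    · rfl
    · exact add_left_comm _ _ _
  have hprod : (η.prod (σ.prod (σ ∗ γ))).map addNoise = σ.prod (σ ∗ (η ∗ γ)) := by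
    have hcomm := measurePreserving_prod_leftComm η σ (σ ∗ γ)
    rw [← Measure.conv_assoc, Measure.conv_comm σ η, Measure.conv_assoc, Measure.conv.eq_def η]
    nth_rw 3 [← Measure.map_id (μ := σ)]
    rw [Measure.map_prod_map _ _ measurable_id (by fun_prop), ← hcomm.map_eq,
      Measure.map_map (by fun_prop) (by fun_prop)]
    rfl
  rw [additiveNoiseInfo, ← hjoint, ← hprod]
  exact (klDiv_map_le _ _ hadd).trans_eq (klDiv_prod_left _ _ _)

/-- The joint law of `(s₂, s₁, s₁ + s₂ + w)`, for independent signals `s₁, s₂` and noise `w` of laws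
`σ₁, σ₂, γ`. -/
noncomputable def twoSignalOutputLaw (σ₁ σ₂ γ : Measure E) : Measure (E × E × E) :=
  (σ₁.prod (signalOutputLaw σ₂ γ)).map fun p => (p.2.1, p.1, p.1 + p.2.2)

instance isProbabilityMeasure_twoSignalOutputLaw :
    IsProbabilityMeasure (twoSignalOutputLaw σ₁ σ₂ γ) :=
  Measure.isProbabilityMeasure_map (by fun_prop)

lemma snd_twoSignalOutputLaw :
    (twoSignalOutputLaw σ₁ σ₂ γ).snd = signalOutputLaw σ₁ (σ₂ ∗ γ) := by
  have h := congrArg (Measure.map fun p : E × E => (p.1, p.1 + p.2))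
    (Measure.map_prod_map σ₁ (signalOutputLaw σ₂ γ) measurable_id measurable_snd)
  rw [Measure.map_map (by fun_prop) (by fun_prop), Measure.map_id, ← Measure.snd,
    snd_signalOutputLaw] at h
  rw [signalOutputLaw, h, twoSignalOutputLaw, Measure.snd,
    Measure.map_map (by fun_prop) (by fun_prop)]
  rfl

lemma klDiv_twoSignalOutputLaw_le :
    klDiv (twoSignalOutputLaw σ₁ σ₂ γ) (σ₂.prod (signalOutputLaw σ₁ (σ₂ ∗ γ)))
      ≤ additiveNoiseInfo σ₂ γ := by
  have hcomm := measurePreserving_prod_leftComm σ₁ σ₂ (σ₂ ∗ γ)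
  have href : σ₂.prod (signalOutputLaw σ₁ (σ₂ ∗ γ))
      = (σ₁.prod (σ₂.prod (σ₂ ∗ γ))).map fun p => (p.2.1, p.1, p.1 + p.2.2) := by
    rw [signalOutputLaw]
    nth_rw 1 [← Measure.map_id (μ := σ₂)]
    rw [Measure.map_prod_map _ _ measurable_id (by fun_prop), ← hcomm.map_eq,
      Measure.map_map (by fun_prop) (by fun_prop)]
    rfl
  rw [href, twoSignalOutputLaw]
  exact (klDiv_map_le _ _ (by fun_prop)).trans_eq (klDiv_prod_left _ _ _)

variable [StandardBorelSpace E]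

lemma klDiv_twoSignalOutputLaw_prod :
    klDiv (twoSignalOutputLaw σ₁ σ₂ γ) (σ₂.prod (σ₁.prod η))
      = klDiv (signalOutputLaw (σ₁ ∗ σ₂) γ) ((σ₁ ∗ σ₂).prod η) := by
  let rearrange : (E × E) × E → E × E × E := fun p => (p.1.2, p.1.1, p.2)
  have hre : Measurable rearrange := by fun_prop
  have hlaw : twoSignalOutputLaw σ₁ σ₂ γ
      = (((σ₁.prod σ₂).prod γ).map fun p => (p.1, p.1.1 + p.1.2 + p.2)).map rearrange := by
    rw [twoSignalOutputLaw, signalOutputLaw]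
    nth_rw 1 [← Measure.map_id (μ := σ₁)]
    rw [Measure.map_prod_map _ _ measurable_id (by fun_prop),
      ← (measurePreserving_prodAssoc σ₁ σ₂ γ).map_eq, Measure.map_map (by fun_prop) (by fun_prop),
      Measure.map_map (by fun_prop) (by fun_prop), Measure.map_map (by fun_prop) (by fun_prop)]
    congr 1
    ext p
    · rfl
    · rfl
    · exact (add_assoc _ _ _).symm
  have href : σ₂.prod (σ₁.prod η) = ((σ₁.prod σ₂).prod η).map rearrange :=
    ((measurePreserving_prod_leftComm σ₁ σ₂ η).comp
      (measurePreserving_prodAssoc σ₁ σ₂ η)).map_eq.symm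
  have := Measure.isProbabilityMeasure_map (μ := (σ₁.prod σ₂).prod γ)
    (f := fun p => (p.1, p.1.1 + p.1.2 + p.2)) (by fun_prop)
  rw [hlaw, href, klDiv_map_of_leftInverse _ _ hre
    (g := fun q => ((q.2.1, q.1), q.2.2)) (by fun_prop) fun _ => rfl]
  exact klDiv_map_add (σ₁.prod σ₂) γ η measurable_add

/-- The two signals are decoded one after the other. -/
lemma additiveNoiseInfo_conv_le :
    additiveNoiseInfo (σ₁ ∗ σ₂) γ ≤ additiveNoiseInfo σ₁ γ + additiveNoiseInfo σ₂ γ := by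
  calc additiveNoiseInfo (σ₁ ∗ σ₂) γ
    _ = klDiv (twoSignalOutputLaw σ₁ σ₂ γ) (σ₂.prod (σ₁.prod (σ₁ ∗ (σ₂ ∗ γ)))) := by
      rw [klDiv_twoSignalOutputLaw_prod, additiveNoiseInfo, Measure.conv_assoc]
    _ = additiveNoiseInfo σ₁ (σ₂ ∗ γ)
        + klDiv (twoSignalOutputLaw σ₁ σ₂ γ) (σ₂.prod (signalOutputLaw σ₁ (σ₂ ∗ γ))) := by
      rw [klDiv_prod_eq_snd_add, snd_twoSignalOutputLaw, additiveNoiseInfo]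
    _ ≤ additiveNoiseInfo σ₁ γ + additiveNoiseInfo σ₂ γ :=
      add_le_add (additiveNoiseInfo_conv_noise_le _ _ _) (klDiv_twoSignalOutputLaw_le _ _ _)

lemma additiveNoiseInfo_map_sum_le {Ω ι : Type*} [MeasurableSpace Ω] {π : Measure Ω}
    [IsProbabilityMeasure π] {X : ι → Ω → E} (hX : ∀ i, Measurable (X i)) (hind : iIndepFun X π)
    (s : Finset ι) :
    additiveNoiseInfo (π.map (∑ i ∈ s, X i)) γ ≤ ∑ i ∈ s, additiveNoiseInfo (π.map (X i)) γ := by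
  induction s using Finset.cons_induction with
  | empty => simp [Pi.zero_def, additiveNoiseInfo_dirac_zero]
  | cons i s hi ih =>
    have hs : Measurable (∑ j ∈ s, X j) := by fun_prop
    have := Measure.isProbabilityMeasure_map (μ := π) hs.aemeasurable
    have := Measure.isProbabilityMeasure_map (μ := π) (hX i).aemeasurable
    rw [Finset.sum_cons, Finset.sum_cons, (hind.indepFun_finsetSum_of_notMem hX
      hi).symm.map_add_eq_map_conv_map (hX i) hs]
    exact (additiveNoiseInfo_conv_le _ _ _).trans (by gcongr)

end SumsOfSignals

section TwoOutputs

variable {E F : Type*} [AddCommGroup E] [MeasurableSpace E] [MeasurableAdd₂ E]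
  [StandardBorelSpace E] [AddCommGroup F] [MeasurableSpace F] [MeasurableAdd₂ F]
  [StandardBorelSpace F] (σ : Measure (E × F)) (γ : Measure E) (γ' : Measure F)
  [IsProbabilityMeasure σ] [IsProbabilityMeasure γ] [IsProbabilityMeasure γ']

lemma additiveNoiseInfo_prod_le :
    additiveNoiseInfo σ (γ.prod γ') ≤ additiveNoiseInfo σ.fst γ + additiveNoiseInfo σ.snd γ' := by
  let Q := σ.fst ∗ γ
  let Q' := σ.snd ∗ γ'
  let M := (σ.prod γ).map fun p => (p.1, p.1.1 + p.2)
  have : IsProbabilityMeasure M := Measure.isProbabilityMeasure_map (by fun_prop)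
  have hM : klDiv M (σ.prod Q) = additiveNoiseInfo σ.fst γ :=
    klDiv_map_add σ γ Q measurable_fst
  let M' := (M.prod γ').map fun p => (p.1, p.1.1.2 + p.2)
  have : IsProbabilityMeasure M' := Measure.isProbabilityMeasure_map (by fun_prop)
  have hfst : M'.fst = M :=
    (Measure.fst_map_prodMk (by fun_prop)).trans Measure.fst_prod
  have hσ : M.fst = σ :=
    (Measure.fst_map_prodMk (by fun_prop)).trans Measure.fst_prod
  have hM' : klDiv M' (M.prod Q') = additiveNoiseInfo σ.snd γ' := by
    have hsignal : M.map (fun q => q.1.2) = σ.snd := by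
      rw [← hσ, Measure.fst, Measure.snd, Measure.map_map measurable_snd measurable_fst]
      rfl
    rw [klDiv_map_add M γ' Q' (f := fun q => q.1.2) (by fun_prop), hsignal, additiveNoiseInfo]
  calc additiveNoiseInfo σ (γ.prod γ')
    _ ≤ klDiv (signalOutputLaw σ (γ.prod γ')) (σ.prod (Q.prod Q')) := by
      rw [← additiveNoiseInfo_add_klDiv_conv]
      exact le_self_add
    _ = klDiv M' ((σ.prod Q).prod Q') := by
      have hlaw : signalOutputLaw σ (γ.prod γ') = M'.map MeasurableEquiv.prodAssoc := by
        simp only [M', M, signalOutputLaw]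
        nth_rw 2 [← Measure.map_id (μ := γ')]
        rw [Measure.map_prod_map _ _ (by fun_prop) measurable_id,
          ← (measurePreserving_prodAssoc σ γ γ').map_eq, Measure.map_map (by fun_prop)
          (by fun_prop), Measure.map_map (by fun_prop) (by fun_prop), Measure.map_map (by fun_prop)
          (by fun_prop)]
        rfl
      rw [hlaw, ← (measurePreserving_prodAssoc σ Q Q').map_eq, klDiv_map_of_leftInverse _ _
        MeasurableEquiv.prodAssoc.measurable MeasurableEquiv.prodAssoc.symm.measurable
        MeasurableEquiv.prodAssoc.left_inv]
    _ = additiveNoiseInfo σ.fst γ + additiveNoiseInfo σ.snd γ' := by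
      rw [klDiv_prod_eq_fst_add, hfst, hM, hM']

end TwoOutputs

/-! ### White Gaussian noise -/

section IsometrySplitting

variable {E F : Type*} [NormedAddCommGroup E] [InnerProductSpace ℝ E] [CompleteSpace E]
  [NormedAddCommGroup F] [InnerProductSpace ℝ F] [CompleteSpace F] (j : F →ₗᵢ[ℝ] E)

/-- The orthogonal splitting `y ↦ (j† y, y - j (j† y))` of a vector along the range of an
isometry `j`. -/
noncomputable def isometrySplitting : E →+ F × E where
  toFun y := (j.toContinuousLinearMap.adjoint y, y - j (j.toContinuousLinearMap.adjoint y))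
  map_zero' := by simp only [map_zero, sub_zero, Prod.mk_zero_zero]
  map_add' x y := by simp only [map_add, add_sub_add_comm, Prod.mk_add_mk]

lemma adjoint_linearIsometry_apply_self (s : F) : j.toContinuousLinearMap.adjoint (j s) = s :=
  congrArg (· s) j.adjoint_comp_self

lemma isometrySplitting_apply_self (s : F) : isometrySplitting j (j s) = (s, 0) := by
  simp [isometrySplitting, adjoint_linearIsometry_apply_self]

lemma leftInverse_isometrySplitting :
    Function.LeftInverse (fun p : F × E => j p.1 + p.2) (isometrySplitting j) := fun y =>
  add_sub_cancel (j (j.toContinuousLinearMap.adjoint y)) y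

lemma measurable_isometrySplitting [MeasurableSpace E] [BorelSpace E] [SecondCountableTopology E]
    [MeasurableSpace F] [BorelSpace F] : Measurable (isometrySplitting j) := by
  change Measurable fun y =>
    (j.toContinuousLinearMap.adjoint y, y - j (j.toContinuousLinearMap.adjoint y))
  fun_prop

end IsometrySplitting

section WhiteNoise

lemma charFun_map_of_inner_eq {E F : Type*} [NormedAddCommGroup E] [InnerProductSpace ℝ E]
    [MeasurableSpace E] [NormedAddCommGroup F] [InnerProductSpace ℝ F] [MeasurableSpace F]
    [BorelSpace F] [SecondCountableTopology F] (γ : Measure E) {f : E → F} (hf : Measurable f)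
    {s : E} {t : F} (h : ∀ x, inner ℝ (f x) t = inner ℝ x s) :
    charFun (γ.map f) t = charFun γ s := by
  rw [charFun_apply, integral_map hf.aemeasurable (by fun_prop), charFun_apply]
  simp only [h]

/-- Circularly symmetric Gaussian noise of variance `v` per complex dimension, on a real inner
product space: its coordinates in an orthonormal basis are independent, of variance `v / 2`. -/
def IsWhiteNoise {E : Type*} [NormedAddCommGroup E] [InnerProductSpace ℝ E] [MeasurableSpace E]
    (γ : Measure E) (v : ℝ≥0) : Prop :=
  ∀ t, charFun γ t = Complex.exp (-(v * ‖t‖ ^ 2 / 4 : ℝ))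

instance isProbabilityMeasure_complexGaussian (v : ℝ≥0) :
    IsProbabilityMeasure (complexGaussian v) :=
  Measure.isProbabilityMeasure_map (by fun_prop)

lemma isWhiteNoise_complexGaussian (v : ℝ≥0) : IsWhiteNoise (complexGaussian v) v := fun t => by
  have hsplit (p : ℝ × ℝ) :
      Complex.exp ((inner ℝ ((p.1 : ℂ) + (p.2 : ℂ) * Complex.I) t : ℝ) * Complex.I)
        = Complex.exp ((inner ℝ p.1 t.re : ℝ) * Complex.I)
          * Complex.exp ((inner ℝ p.2 t.im : ℝ) * Complex.I) := by
    rw [← Complex.exp_add, ← add_mul, ← Complex.ofReal_add]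
    congr 3
    simp [Complex.inner]
  rw [charFun_apply, complexGaussian, integral_map (by fun_prop) (by fun_prop)]
  simp only [hsplit]
  rw [integral_prod_mul (fun x : ℝ => Complex.exp ((inner ℝ x t.re : ℝ) * Complex.I))
    (fun x : ℝ => Complex.exp ((inner ℝ x t.im : ℝ) * Complex.I)), ← charFun_apply,
    ← charFun_apply, charFun_gaussianReal, charFun_gaussianReal, ← Complex.exp_add,
    Complex.sq_norm, Complex.normSq_apply]
  congr 1
  push_cast
  ring

namespace IsWhiteNoise

lemma pi {ι E : Type*} [Fintype ι] [NormedAddCommGroup E] [InnerProductSpace ℝ E]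
    [MeasurableSpace E] {γ : Measure E} [SigmaFinite γ] {v : ℝ≥0} (hγ : IsWhiteNoise γ v) :
    IsWhiteNoise ((Measure.pi fun _ : ι => γ).map (WithLp.toLp 2)) v := fun t => by
  rw [charFun_pi]
  simp only [hγ _]
  rw [← Complex.exp_sum, PiLp.norm_sq_eq_of_L2]
  push_cast
  rw [Finset.mul_sum, Finset.sum_div, Finset.sum_neg_distrib]

variable {E F : Type*} [NormedAddCommGroup E] [InnerProductSpace ℝ E] [MeasurableSpace E]
  [NormedAddCommGroup F] [InnerProductSpace ℝ F] [MeasurableSpace F]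
  {γ γ' : Measure E} {δ : Measure F} {v w : ℝ≥0}

lemma prod [SFinite γ] [SFinite δ] (hγ : IsWhiteNoise γ v) (hδ : IsWhiteNoise δ v) :
    IsWhiteNoise ((γ.prod δ).map (WithLp.toLp 2)) v := fun t => by
  rw [charFun_prod, hγ, hδ, ← Complex.exp_add, WithLp.prod_norm_sq_eq_of_L2]
  simp only [WithLp.ofLp_fst, WithLp.ofLp_snd]
  push_cast
  ring_nf

lemma conv [BorelSpace E] [SecondCountableTopology E] [IsFiniteMeasure γ] [IsFiniteMeasure γ']
    (hγ : IsWhiteNoise γ v) (hγ' : IsWhiteNoise γ' w) :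
    IsWhiteNoise (γ ∗ γ') (v + w) := fun t => by
  rw [charFun_conv, hγ, hγ', ← Complex.exp_add]
  push_cast
  ring_nf

variable [BorelSpace E] [BorelSpace F] [CompleteSpace E] [CompleteSpace F]
  [SecondCountableTopology F]

lemma map_adjoint (hγ : IsWhiteNoise γ v) (j : F →ₗᵢ[ℝ] E) :
    IsWhiteNoise (γ.map j.toContinuousLinearMap.adjoint) v := fun t => by
  rw [charFun_map_of_inner_eq γ (ContinuousLinearMap.measurable _) (s := j t) fun x => ?_, hγ,
    j.norm_map]
  exact ContinuousLinearMap.adjoint_inner_left _ _ _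

variable [SecondCountableTopology E] [IsFiniteMeasure γ]

lemma ext [IsFiniteMeasure γ'] (hγ : IsWhiteNoise γ v) (hγ' : IsWhiteNoise γ' v) : γ = γ' :=
  Measure.ext_of_charFun (funext fun t => (hγ t).trans (hγ' t).symm)

lemma indepFun_adjoint (hγ : IsWhiteNoise γ v) (j : F →ₗᵢ[ℝ] E) :
    IndepFun j.toContinuousLinearMap.adjoint
      (fun y => y - j (j.toContinuousLinearMap.adjoint y)) γ := by
  set p := j.toContinuousLinearMap.adjoint
  have hp (x : E) (s : F) : inner ℝ (p x) s = inner ℝ x (j s) :=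
    ContinuousLinearMap.adjoint_inner_left _ _ _
  have hq (x t : E) : inner ℝ (x - j (p x)) t = inner ℝ x (t - j (p t)) := by
    rw [inner_sub_left, inner_sub_right, ← hp x, real_inner_comm t (j _), ← hp t,
      real_inner_comm (p x)]
  rw [indepFun_iff_charFun_prod (by fun_prop) (by fun_prop)]
  intro t
  have horth : inner ℝ (j t.fst) (t.snd - j (p t.snd)) = 0 := by
    rw [← hq, adjoint_linearIsometry_apply_self, sub_self, inner_zero_left]
  simp only [WithLp.ofLp_fst, WithLp.ofLp_snd]
  rw [charFun_map_of_inner_eq γ (s := j t.fst + (t.snd - j (p t.snd))) (by fun_prop) fun x => ?_,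
    charFun_map_of_inner_eq γ (s := j t.fst) (by fun_prop) fun x => hp x _,
    charFun_map_of_inner_eq γ (s := t.snd - j (p t.snd)) (by fun_prop) fun x => hq x _, hγ, hγ, hγ,
    ← Complex.exp_add, norm_add_sq_real, horth]
  · push_cast
    ring_nf
  · rw [WithLp.prod_inner_apply, inner_add_right, ← hp, ← hq]
    rfl

lemma map_isometrySplitting [IsFiniteMeasure δ] (hγ : IsWhiteNoise γ v) (hδ : IsWhiteNoise δ v)
    (j : F →ₗᵢ[ℝ] E) :
    γ.map (isometrySplitting j)
      = δ.prod (γ.map fun y => y - j (j.toContinuousLinearMap.adjoint y)) := by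
  rw [← (hγ.map_adjoint j).ext hδ]
  exact (indepFun_iff_map_prod_eq_prod_map_map (by fun_prop) (by fun_prop)).1
    (hγ.indepFun_adjoint j)

end IsWhiteNoise

lemma complexGaussian_map_mul_left (v : ℝ≥0) (a : ℂ) :
    (complexGaussian v).map (a * ·) = complexGaussian (‖a‖₊ ^ 2 * v) := by
  refine IsWhiteNoise.ext (v := ‖a‖₊ ^ 2 * v) (fun t => ?_) (isWhiteNoise_complexGaussian _)
  rw [charFun_map_of_inner_eq _ (by fun_prop) (s := star a * t) fun x => ?_,
    isWhiteNoise_complexGaussian, norm_mul, norm_star]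
  · push_cast
    ring_nf
  · simp [Complex.inner]
    ring

lemma complexGaussian_conv (v w : ℝ≥0) :
    complexGaussian v ∗ complexGaussian w = complexGaussian (v + w) :=
  ((isWhiteNoise_complexGaussian v).conv (isWhiteNoise_complexGaussian w)).ext
    (isWhiteNoise_complexGaussian _)

lemma exists_linearIsometry_norm_mul {E : Type*} [NormedAddCommGroup E] [InnerProductSpace ℝ E]
    [NormedSpace ℂ E] [IsScalarTower ℝ ℂ E] {a : E} (ha : a ≠ 0) :
    ∃ j : ℂ →ₗᵢ[ℝ] E, ∀ u : ℂ, j (‖a‖ * u) = u • a := by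
  have hunit : ‖(‖a‖⁻¹ : ℂ) • a‖ = 1 := by
    rw [norm_smul, norm_inv, Complex.norm_real, norm_norm, inv_mul_cancel₀ (norm_ne_zero_iff.2 ha)]
  refine ⟨⟨(LinearIsometry.toSpanSingleton ℂ E hunit).toLinearMap.restrictScalars ℝ,
    (LinearIsometry.toSpanSingleton ℂ E hunit).norm_map⟩, fun u => ?_⟩
  have hne : (‖a‖ : ℂ) ≠ 0 := by exact_mod_cast norm_ne_zero_iff.2 ha
  change ((‖a‖ : ℂ) * u) • (‖a‖⁻¹ : ℂ) • a = u • a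
  rw [smul_smul, mul_right_comm, mul_inv_cancel₀ hne, one_mul]

section LinearIsometry

variable {E F : Type*} [NormedAddCommGroup E] [InnerProductSpace ℝ E] [MeasurableSpace E]
  [BorelSpace E] [SecondCountableTopology E] [CompleteSpace E] [NormedAddCommGroup F]
  [InnerProductSpace ℝ F] [MeasurableSpace F] [BorelSpace F] [CompleteSpace F]
  {γ : Measure E} [IsProbabilityMeasure γ] {δ : Measure F} [IsProbabilityMeasure δ] {v : ℝ≥0}

lemma map_linearIsometry_map_isometrySplitting (j : F →ₗᵢ[ℝ] E) (σ : Measure F) [SFinite σ] :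
    (σ.map j).map (isometrySplitting j) = σ.prod (Measure.dirac 0) := by
  rw [Measure.map_map (measurable_isometrySplitting j) j.continuous.measurable, Measure.prod_dirac]
  congr 1
  funext s
  exact isometrySplitting_apply_self j s

variable [SecondCountableTopology F]

lemma additiveNoiseInfo_map_linearIsometry (hγ : IsWhiteNoise γ v) (hδ : IsWhiteNoise δ v)
    (j : F →ₗᵢ[ℝ] E) (σ : Measure F) [IsProbabilityMeasure σ] :
    additiveNoiseInfo (σ.map j) γ = additiveNoiseInfo σ δ := by
  have hj : Measurable j := j.continuous.measurable
  have := Measure.isProbabilityMeasure_map (μ := σ) hj.aemeasurable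
  have := Measure.isProbabilityMeasure_map (μ := γ)
    (f := fun y => y - j (j.toContinuousLinearMap.adjoint y)) (by fun_prop)
  rw [← additiveNoiseInfo_map _ _ (measurable_isometrySplitting j)
      (d := fun p => j p.1 + p.2) (by fun_prop) (leftInverse_isometrySplitting j),
    map_linearIsometry_map_isometrySplitting, hγ.map_isometrySplitting hδ,
    additiveNoiseInfo_prod, additiveNoiseInfo_dirac_zero, add_zero]

lemma klDiv_map_linearIsometry_conv (hγ : IsWhiteNoise γ v) (hδ : IsWhiteNoise δ v)
    (j : F →ₗᵢ[ℝ] E) (σ : Measure F) [IsProbabilityMeasure σ] :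
    klDiv (σ.map j ∗ γ) γ = klDiv (σ ∗ δ) δ := by
  have hj : Measurable j := j.continuous.measurable
  have := Measure.isProbabilityMeasure_map (μ := σ) hj.aemeasurable
  have := Measure.isProbabilityMeasure_map (μ := γ)
    (f := fun y => y - j (j.toContinuousLinearMap.adjoint y)) (by fun_prop)
  rw [← klDiv_map_of_leftInverse _ _ (measurable_isometrySplitting j)
      (g := fun p => j p.1 + p.2) (by fun_prop) (leftInverse_isometrySplitting j),
    Measure.map_conv_addMonoidHom _ (measurable_isometrySplitting j),
    map_linearIsometry_map_isometrySplitting, hγ.map_isometrySplitting hδ, prod_conv_prod,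
    klDiv_prod_prod, Measure.dirac_zero_conv, klDiv_self, add_zero]

lemma additiveNoiseInfo_map_smul [NormedSpace ℂ E] [IsScalarTower ℝ ℂ E]
    (hγ : IsWhiteNoise γ v) (σ : Measure ℂ) [IsProbabilityMeasure σ] (a : E) :
    additiveNoiseInfo (σ.map (· • a)) γ
      = additiveNoiseInfo (σ.map ((‖a‖ : ℂ) * ·)) (complexGaussian v) := by
  rcases eq_or_ne a 0 with rfl | ha
  · simp [additiveNoiseInfo_dirac_zero]
  · obtain ⟨j, hj⟩ := exists_linearIsometry_norm_mul ha
    have := Measure.isProbabilityMeasure_map (μ := σ) (f := ((‖a‖ : ℂ) * ·)) (by fun_prop)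
    rw [← additiveNoiseInfo_map_linearIsometry hγ (isWhiteNoise_complexGaussian v) j,
      Measure.map_map j.continuous.measurable (by fun_prop)]
    simp only [Function.comp_def, hj]

lemma klDiv_map_smul_conv [NormedSpace ℂ E] [IsScalarTower ℝ ℂ E]
    (hγ : IsWhiteNoise γ v) (σ : Measure ℂ) [IsProbabilityMeasure σ] (a : E) :
    klDiv (σ.map (· • a) ∗ γ) γ
      = klDiv (σ.map ((‖a‖ : ℂ) * ·) ∗ complexGaussian v) (complexGaussian v) := by
  rcases eq_or_ne a 0 with rfl | ha
  · simp
  · obtain ⟨j, hj⟩ := exists_linearIsometry_norm_mul ha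
    have := Measure.isProbabilityMeasure_map (μ := σ) (f := ((‖a‖ : ℂ) * ·)) (by fun_prop)
    rw [← klDiv_map_linearIsometry_conv hγ (isWhiteNoise_complexGaussian v) j,
      Measure.map_map j.continuous.measurable (by fun_prop)]
    simp only [Function.comp_def, hj]

end LinearIsometry

lemma additiveNoiseInfo_map_toLp (p : ℝ≥0∞) {E : Type*} [AddCommGroup E] [MeasurableSpace E]
    [MeasurableAdd₂ E] [MeasurableAdd₂ (WithLp p E)] (σ γ : Measure E) [IsProbabilityMeasure σ]
    [IsProbabilityMeasure γ] :
    additiveNoiseInfo (σ.map (WithLp.toLp p)) (γ.map (WithLp.toLp p)) = additiveNoiseInfo σ γ :=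
  additiveNoiseInfo_map σ γ (e := ((WithLp.addEquiv p E).symm : E →+ WithLp p E))
    (WithLp.measurable_toLp p E) (WithLp.measurable_ofLp p E) fun _ => rfl

lemma additiveNoiseInfo_map_mul_pi {ι : Type*} [Fintype ι] (σ : Measure ℂ)
    [IsProbabilityMeasure σ] (v : ℝ≥0) (a : ι → ℂ) :
    additiveNoiseInfo (σ.map fun u i => u * a i) (Measure.pi fun _ => complexGaussian v)
      = additiveNoiseInfo (σ.map ((‖WithLp.toLp 2 a‖ : ℂ) * ·)) (complexGaussian v) := by
  have hW := WithLp.measurable_toLp 2 (ι → ℂ)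
  have := Measure.isProbabilityMeasure_map (μ := σ) (f := fun u i => u * a i) (by fun_prop)
  have := Measure.isProbabilityMeasure_map (μ := Measure.pi fun _ : ι => complexGaussian v)
    hW.aemeasurable
  rw [← additiveNoiseInfo_map_smul (isWhiteNoise_complexGaussian v).pi,
    ← additiveNoiseInfo_map_toLp 2, Measure.map_map hW (by fun_prop)]
  rfl

end WhiteNoise

section ComplexGaussianDensity

lemma map_withDensity_comp {X Y : Type*} [MeasurableSpace X] [MeasurableSpace Y] {μ : Measure X}
    {ν : Measure Y} {f : X → Y} (hf : MeasurePreserving f μ ν) {g : Y → ℝ≥0∞} (hg : Measurable g) :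
    (μ.withDensity (g ∘ f)).map f = ν.withDensity g := by
  ext s hs
  rw [Measure.map_apply hf.measurable hs, withDensity_apply _ (hf.measurable hs),
    withDensity_apply _ hs]
  exact hf.setLIntegral_comp_preimage hs hg

lemma klDiv_withDensity_exp {X : Type*} [MeasurableSpace X] (P Q : Measure X)
    [IsProbabilityMeasure P] [IsProbabilityMeasure Q] {ℓ : X → ℝ} (hℓ : Measurable ℓ)
    (hP : P = Q.withDensity fun x => ENNReal.ofReal (Real.exp (ℓ x))) (hint : Integrable ℓ P) :
    klDiv P Q = ENNReal.ofReal (∫ x, ℓ x ∂P) := by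
  have hac : P ≪ Q := hP ▸ withDensity_absolutelyContinuous _ _
  have hllr : llr P Q =ᵐ[P] ℓ := by
    have h : P.rnDeriv Q =ᵐ[Q] fun x => ENNReal.ofReal (Real.exp (ℓ x)) := by
      conv_lhs => rw [hP]
      exact Measure.rnDeriv_withDensity Q (by fun_prop)
    filter_upwards [hac h] with x hx
    simp only [llr_def]
    rw [hx, ENNReal.toReal_ofReal (Real.exp_pos _).le, Real.log_exp]
  rw [klDiv_of_ac_of_integrable hac (hint.congr hllr.symm), integral_congr_ae hllr]
  simp

/-- The density of `complexGaussian v`, for `v ≠ 0`. -/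
noncomputable def complexGaussianPDF (v : ℝ≥0) (z : ℂ) : ℝ :=
  (Real.pi * v)⁻¹ * Real.exp (-(‖z‖ ^ 2 / v))

lemma measurable_complexGaussianPDF (v : ℝ≥0) : Measurable (complexGaussianPDF v) := by
  unfold complexGaussianPDF
  fun_prop

lemma complexGaussianPDF_nonneg (v : ℝ≥0) (z : ℂ) : 0 ≤ complexGaussianPDF v z := by
  unfold complexGaussianPDF
  positivity

lemma complexGaussian_eq_withDensity {v : ℝ≥0} (hv : v ≠ 0) :
    complexGaussian v = volume.withDensity fun z => ENNReal.ofReal (complexGaussianPDF v z) := by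
  have hv2 : v / 2 ≠ 0 := div_ne_zero hv two_ne_zero
  rw [← map_withDensity_comp (Complex.volume_preserving_equiv_real_prod.symm _)
    (measurable_complexGaussianPDF v).ennreal_ofReal, complexGaussian,
    gaussianReal_of_var_ne_zero _ hv2, prod_withDensity (by fun_prop) (by fun_prop),
    ← Measure.volume_eq_prod]
  congr 2
  · funext p
    exact (Complex.mk_eq_add_mul_I _ _).symm
  · funext p
    change _ = ENNReal.ofReal (complexGaussianPDF v ⟨p.1, p.2⟩)
    rw [gaussianPDF_def, ← ENNReal.ofReal_mul (gaussianPDFReal_nonneg _ _ _), complexGaussianPDF,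
      gaussianPDFReal, gaussianPDFReal, mul_mul_mul_comm, ← Real.exp_add, ← mul_inv,
      Real.mul_self_sqrt (by positivity), Complex.sq_norm, Complex.normSq_apply]
    have : (v : ℝ) ≠ 0 := by exact_mod_cast hv
    congr 3
    · push_cast
      ring
    · push_cast
      field_simp
      ring

lemma memLp_id_complexGaussian (v : ℝ≥0) : MemLp id 2 (complexGaussian v) := by
  have h := memLp_id_gaussianReal' (μ := 0) (v := v / 2) 2 (by norm_num)
  have hre : MemLp (fun p : ℝ × ℝ => (p.1 : ℂ)) 2
      ((gaussianReal 0 (v / 2)).prod (gaussianReal 0 (v / 2))) := (h.comp_fst _).ofReal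
  have him : MemLp (fun p : ℝ × ℝ => (p.2 : ℂ)) 2
      ((gaussianReal 0 (v / 2)).prod (gaussianReal 0 (v / 2))) := (h.comp_snd _).ofReal
  rw [complexGaussian, memLp_map_measure_iff (by fun_prop) (by fun_prop)]
  exact hre.add (him.mul_const Complex.I)

lemma integral_id_complexGaussian (v : ℝ≥0) : ∫ w, w ∂complexGaussian v = 0 := by
  have h := integral_map (μ := complexGaussian v) (φ := ((-1 : ℂ) * ·)) (f := id) (by fun_prop)
    (by fun_prop)
  rw [complexGaussian_map_mul_left] at h
  simp only [id, nnnorm_neg, nnnorm_one, one_pow, one_mul, neg_mul] at h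
  exact self_eq_neg.1 (h.trans (integral_neg _))

lemma integral_sq_norm_complexGaussian (v : ℝ≥0) : ∫ w, ‖w‖ ^ 2 ∂complexGaussian v = v := by
  have hvar : ∫ x, x ^ 2 ∂gaussianReal 0 (v / 2) = v / 2 := by
    have h := variance_of_integral_eq_zero (X := id) (μ := gaussianReal 0 (v / 2))
      aemeasurable_id integral_id_gaussianReal
    rw [variance_id_gaussianReal] at h
    exact_mod_cast h.symm
  have hint : Integrable (fun x : ℝ => x ^ 2) (gaussianReal 0 (v / 2)) :=
    (memLp_id_gaussianReal' 2 (by norm_num)).integrable_sq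
  rw [complexGaussian, integral_map (by fun_prop) (by fun_prop)]
  have hnorm (p : ℝ × ℝ) : ‖(p.1 : ℂ) + p.2 * Complex.I‖ ^ 2 = p.1 ^ 2 + p.2 ^ 2 := by
    rw [Complex.sq_norm, Complex.normSq_add_mul_I]
  simp only [hnorm]
  rw [integral_add (hint.comp_fst _) (hint.comp_snd _), integral_fun_fst (fun x : ℝ => x ^ 2),
    integral_fun_snd (fun x : ℝ => x ^ 2), hvar]
  simp

lemma klDiv_complexGaussian {s v : ℝ≥0} (hs : s ≠ 0) (hv : v ≠ 0) :
    klDiv (complexGaussian s) (complexGaussian v)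
      = ENNReal.ofReal (s / v - 1 - Real.log (s / v)) := by
  have hs' : (s : ℝ) ≠ 0 := by exact_mod_cast hs
  have hv' : (v : ℝ) ≠ 0 := by exact_mod_cast hv
  have hsq : Integrable (fun z : ℂ => ‖z‖ ^ 2) (complexGaussian s) :=
    (memLp_id_complexGaussian s).integrable_norm_pow two_ne_zero
  have hlog : Real.exp (Real.log (s / v)) = s / v := Real.exp_log (by positivity)
  have hpdf (z : ℂ) : complexGaussianPDF s z
      = complexGaussianPDF v z * Real.exp ((1 / v - 1 / s) * ‖z‖ ^ 2 - Real.log (s / v)) := by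
    rw [complexGaussianPDF, complexGaussianPDF, Real.exp_sub, hlog, mul_div_assoc', mul_assoc,
      ← Real.exp_add]
    have hexp : -(‖z‖ ^ 2 / v) + (1 / v - 1 / s) * ‖z‖ ^ 2 = -(‖z‖ ^ 2 / s) := by ring
    rw [hexp]
    field_simp
  rw [klDiv_withDensity_exp (ℓ := fun z : ℂ => (1 / v - 1 / s) * ‖z‖ ^ 2 - Real.log (s / v))
    _ _ (by fun_prop) ?_ ((hsq.const_mul _).sub (integrable_const _)),
    integral_sub (hsq.const_mul _) (integrable_const _), integral_const_mul,
    integral_sq_norm_complexGaussian]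
  · congr 1
    simp only [one_div, integral_const, probReal_univ, smul_eq_mul, one_mul, sub_left_inj]
    field_simp
  · rw [complexGaussian_eq_withDensity hs, complexGaussian_eq_withDensity hv,
      ← withDensity_mul _ (measurable_complexGaussianPDF v).ennreal_ofReal (by fun_prop)]
    congr 1
    funext z
    rw [hpdf, ENNReal.ofReal_mul (complexGaussianPDF_nonneg v z)]
    rfl

lemma signalOutputLaw_complexGaussian (σ : Measure ℂ) [IsProbabilityMeasure σ] {v : ℝ≥0}
    (hv : v ≠ 0) :
    signalOutputLaw σ (complexGaussian v) = (σ.prod (complexGaussian v)).withDensity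
      fun p => ENNReal.ofReal (Real.exp ((‖p.2‖ ^ 2 - ‖p.2 - p.1‖ ^ 2) / v)) := by
  have hg : Measurable fun p : ℂ × ℂ => ENNReal.ofReal (complexGaussianPDF v (p.2 - p.1)) :=
    (measurable_complexGaussianPDF v).ennreal_ofReal.comp (by fun_prop)
  have hshear := map_withDensity_comp (measurePreserving_prod_add σ (volume : Measure ℂ)) hg
  have hpdf (p : ℂ × ℂ) : complexGaussianPDF v (p.2 - p.1) = complexGaussianPDF v p.2
      * Real.exp ((‖p.2‖ ^ 2 - ‖p.2 - p.1‖ ^ 2) / v) := by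
    rw [complexGaussianPDF, complexGaussianPDF, mul_assoc, ← Real.exp_add]
    ring_nf
  have hpdf_meas := (measurable_complexGaussianPDF v).ennreal_ofReal
  have hpdf_snd : Measurable fun p : ℂ × ℂ => ENNReal.ofReal (complexGaussianPDF v p.2) :=
    hpdf_meas.comp measurable_snd
  rw [complexGaussian_eq_withDensity hv, signalOutputLaw, prod_withDensity_right hpdf_meas,
    ← withDensity_mul _ hpdf_snd (by fun_prop)]
  convert hshear using 3
  · funext p
    simp only [Function.comp_apply, add_sub_cancel_left]
  · rw [hpdf, ENNReal.ofReal_mul (complexGaussianPDF_nonneg v _)]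
    rfl

lemma klDiv_signalOutputLaw_complexGaussian (σ : Measure ℂ) [IsProbabilityMeasure σ]
    (hσ : MemLp id 2 σ) {v : ℝ≥0} (hv : v ≠ 0) :
    klDiv (signalOutputLaw σ (complexGaussian v)) (σ.prod (complexGaussian v))
      = ENNReal.ofReal ((∫ c, ‖c‖ ^ 2 ∂σ) / v) := by
  have hexpand (p : ℂ × ℂ) : (‖p.1 + p.2‖ ^ 2 - ‖p.1 + p.2 - p.1‖ ^ 2) / v
      = (‖p.1‖ ^ 2 + 2 * inner ℝ p.1 p.2) / v := by
    rw [add_sub_cancel_left, norm_add_sq_real]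
    ring
  have hγ := memLp_id_complexGaussian v
  have hsq : Integrable (fun c : ℂ => ‖c‖ ^ 2) σ := hσ.integrable_norm_pow two_ne_zero
  have hinner : Integrable (fun p : ℂ × ℂ => inner ℝ p.1 p.2) (σ.prod (complexGaussian v)) := by
    refine ((hσ.integrable one_le_two).norm.mul_prod (hγ.integrable one_le_two).norm).mono'
      (by fun_prop) (.of_forall fun p => ?_)
    exact norm_inner_le_norm _ _
  have hinner_zero : ∫ p : ℂ × ℂ, inner ℝ p.1 p.2 ∂σ.prod (complexGaussian v) = 0 := by
    have hzero (c : ℂ) : ∫ w : ℂ, inner ℝ c w ∂complexGaussian v = 0 := by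
      rw [integral_inner (f := fun w : ℂ => w) (hγ.integrable one_le_two) c,
        integral_id_complexGaussian, inner_zero_right]
    rw [integral_prod _ hinner]
    simp only [hzero, integral_zero]
  have hsum : Integrable (fun p : ℂ × ℂ => (‖p.1‖ ^ 2 + 2 * inner ℝ p.1 p.2) / v)
      (σ.prod (complexGaussian v)) :=
    ((hsq.comp_fst (complexGaussian v)).add (hinner.const_mul 2)).div_const v
  rw [klDiv_withDensity_exp _ _ (by fun_prop) (signalOutputLaw_complexGaussian σ hv) ?_,
    signalOutputLaw, integral_map (by fun_prop) (by fun_prop)]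
  · simp only [hexpand]
    rw [integral_div, integral_add (hsq.comp_fst _) (hinner.const_mul 2), integral_const_mul,
      hinner_zero, integral_fun_fst (fun c : ℂ => ‖c‖ ^ 2)]
    simp
  · rw [signalOutputLaw, integrable_map_measure (by fun_prop) (by fun_prop)]
    simpa only [Function.comp_def, hexpand] using hsum

end ComplexGaussianDensity

/-! ### Scalar Gaussian channel -/

section ScalarChannel

/-- The information, in nats, conveyed about `u` by `√ρ u + w`, where `u` has law `ν` and `w` is
complex Gaussian of variance `1`. -/
noncomputable def snrInfo (ν : Measure ℂ) (ρ : ℝ≥0) : ℝ≥0∞ :=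
  additiveNoiseInfo (ν.map ((Real.sqrt ρ : ℂ) * ·)) (complexGaussian 1)

/-- The divergence of the law of `√ρ u + w` from that of the noise `w`, where `u` has law `ν` and
`w` is complex Gaussian of variance `1`. -/
noncomputable def snrDiv (ν : Measure ℂ) (ρ : ℝ≥0) : ℝ≥0∞ :=
  klDiv (ν.map ((Real.sqrt ρ : ℂ) * ·) ∗ complexGaussian 1) (complexGaussian 1)

variable (ν : Measure ℂ) [IsProbabilityMeasure ν]

lemma scalarRate_eq (ρ : ℝ≥0) : scalarRate ν ρ = snrInfo ν ρ / ENNReal.ofReal (Real.log 2) := by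
  have h := mutualInfoBits_add_noise ν (complexGaussian 1) (x := id) measurable_id
    (f := ((Real.sqrt ρ : ℂ) * ·)) (by fun_prop)
  rwa [Measure.map_id] at h

lemma snrInfo_zero : snrInfo ν 0 = 0 := by
  simp [snrInfo, additiveNoiseInfo_dirac_zero]

lemma additiveNoiseInfo_map_mul (a : ℂ) {v : ℝ≥0} (hv : v ≠ 0) :
    additiveNoiseInfo (ν.map (a * ·)) (complexGaussian v) = snrInfo ν (‖a‖₊ ^ 2 / v) := by
  have hrot := additiveNoiseInfo_map_smul (isWhiteNoise_complexGaussian v) ν a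
  simp only [smul_eq_mul, mul_comm _ a] at hrot
  have hsqrt : (Real.sqrt v : ℂ) ≠ 0 := by
    simpa only [ne_eq, Complex.ofReal_eq_zero, Real.sqrt_eq_zero', not_le, NNReal.coe_pos]
      using pos_iff_ne_zero.2 hv
  have := Measure.isProbabilityMeasure_map (μ := ν) (f := ((‖a‖ : ℂ) * ·)) (by fun_prop)
  have hscale := additiveNoiseInfo_map (ν.map ((‖a‖ : ℂ) * ·)) (complexGaussian v)
    (e := AddMonoidHom.mulLeft ((Real.sqrt v : ℂ)⁻¹)) (d := ((Real.sqrt v : ℂ) * ·))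
    (measurable_const_mul _) (by fun_prop) fun z => mul_inv_cancel_left₀ hsqrt z
  rw [hrot, ← hscale, snrInfo]
  simp only [AddMonoidHom.coe_mulLeft]
  rw [complexGaussian_map_mul_left, Measure.map_map (by fun_prop) (by fun_prop)]
  have hvar : ‖((Real.sqrt v : ℂ)⁻¹)‖₊ ^ 2 * v = 1 := by
    refine NNReal.coe_injective ?_
    push_cast
    rw [norm_inv, Complex.norm_real, Real.norm_of_nonneg (Real.sqrt_nonneg _), inv_pow,
      Real.sq_sqrt v.coe_nonneg, inv_mul_cancel₀ (by exact_mod_cast hv)]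
  rw [hvar]
  congr 2
  funext u
  push_cast
  rw [Function.comp_apply, Real.sqrt_div (by positivity), Real.sqrt_sq (norm_nonneg a),
    Complex.ofReal_div, div_eq_inv_mul, mul_assoc]

lemma additiveNoiseInfo_complexGaussian {v : ℝ≥0} (hv : v ≠ 0) :
    additiveNoiseInfo ν (complexGaussian v) = snrInfo ν v⁻¹ := by
  simpa using additiveNoiseInfo_map_mul ν 1 hv

lemma snrInfo_mono : Monotone (snrInfo ν) := by
  intro r s hrs
  rcases eq_or_ne r 0 with rfl | hr
  · rw [snrInfo_zero]
    exact zero_le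
  · have hs : s ≠ 0 := (hr.bot_lt.trans_le hrs).ne'
    have hinv : s⁻¹ ≤ r⁻¹ := inv_anti₀ hr.bot_lt hrs
    have hdegrade := additiveNoiseInfo_conv_noise_le ν (complexGaussian s⁻¹)
      (complexGaussian (r⁻¹ - s⁻¹))
    rwa [complexGaussian_conv, tsub_add_cancel_of_le hinv,
      additiveNoiseInfo_complexGaussian ν (inv_ne_zero hr),
      additiveNoiseInfo_complexGaussian ν (inv_ne_zero hs), inv_inv, inv_inv] at hdegrade

lemma snrInfo_add_snrDiv (hν : ∫ u, ‖u‖ ^ 2 ∂ν = 1) (ρ : ℝ≥0) :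
    snrInfo ν ρ + snrDiv ν ρ = ρ := by
  have hmem : MemLp id 2 ν := by
    refine (memLp_two_iff_integrable_sq_norm (by fun_prop)).2 (Integrable.of_integral_ne_zero ?_)
    simp [hν]
  have hmap : MemLp id 2 (ν.map ((Real.sqrt ρ : ℂ) * ·)) :=
    (memLp_map_measure_iff (by fun_prop) (by fun_prop)).2 (hmem.const_mul _)
  have := Measure.isProbabilityMeasure_map (μ := ν) (f := ((Real.sqrt ρ : ℂ) * ·)) (by fun_prop)
  rw [snrInfo, snrDiv, additiveNoiseInfo_add_klDiv_conv,
    klDiv_signalOutputLaw_complexGaussian _ hmap one_ne_zero,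
    integral_map (by fun_prop) (by fun_prop)]
  simp [mul_pow, integral_const_mul, hν, Real.sq_sqrt ρ.coe_nonneg]

lemma snrDiv_ne_top (hν : ∫ u, ‖u‖ ^ 2 ∂ν = 1) (ρ : ℝ≥0) : snrDiv ν ρ ≠ ∞ := by
  refine ne_top_of_le_ne_top (ENNReal.coe_ne_top (r := ρ)) ?_
  rw [← snrInfo_add_snrDiv ν hν]
  exact le_add_self

lemma snrInfo_ne_top (hν : ∫ u, ‖u‖ ^ 2 ∂ν = 1) (ρ : ℝ≥0) : snrInfo ν ρ ≠ ∞ := by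
  refine ne_top_of_le_ne_top (ENNReal.coe_ne_top (r := ρ)) ?_
  rw [← snrInfo_add_snrDiv ν hν]
  exact le_self_add

lemma klDiv_map_conv_eq_snrDiv {E H : Type*} [AddCommGroup E] [MeasurableSpace E]
    [MeasurableAdd₂ E] [NormedAddCommGroup H] [InnerProductSpace ℝ H] [NormedSpace ℂ H]
    [IsScalarTower ℝ ℂ H] [CompleteSpace H] [MeasurableSpace H] [BorelSpace H]
    [SecondCountableTopology H] {γ : Measure E} [IsProbabilityMeasure γ] {e : E →+ H}
    (he : Measurable e) {d : H → E} (hd : Measurable d) (hde : Function.LeftInverse d e)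
    (hγ : IsWhiteNoise (γ.map e) 1) {s : ℂ → E} (hs : Measurable s) {a : H}
    (hsa : ∀ u, e (s u) = u • a) {ρ : ℝ≥0} (ha : ‖a‖ ^ 2 = ρ) :
    klDiv (ν.map s ∗ γ) γ = snrDiv ν ρ := by
  have := Measure.isProbabilityMeasure_map (μ := ν) hs.aemeasurable
  have := Measure.isProbabilityMeasure_map (μ := γ) he.aemeasurable
  have hsa' : e ∘ s = (· • a) := funext hsa
  rw [← klDiv_map_of_leftInverse _ _ he hd hde, Measure.map_conv_addMonoidHom _ he,
    Measure.map_map he hs, hsa', klDiv_map_smul_conv hγ, snrDiv, ← ha,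
    Real.sqrt_sq (norm_nonneg a)]

lemma fst_conv {E F : Type*} [AddCommGroup E] [MeasurableSpace E] [MeasurableAdd₂ E]
    [AddCommGroup F] [MeasurableSpace F] [MeasurableAdd₂ F] (μ η : Measure (E × F)) [SFinite μ]
    [SFinite η] : (μ ∗ η).fst = μ.fst ∗ η.fst :=
  Measure.map_conv_addMonoidHom (AddMonoidHom.fst E F) measurable_fst

lemma sq_norm_ofReal_sqrt (x : ℝ≥0) : ‖(Real.sqrt x : ℂ)‖ ^ 2 = x := by
  rw [Complex.norm_real, Real.norm_of_nonneg (Real.sqrt_nonneg _), Real.sq_sqrt x.coe_nonneg]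

lemma klDiv_pair_conv (x y : ℝ≥0) :
    klDiv (ν.map (fun u : ℂ => (u * Real.sqrt x, u * Real.sqrt y))
        ∗ (complexGaussian 1).prod (complexGaussian 1))
      ((complexGaussian 1).prod (complexGaussian 1)) = snrDiv ν (x + y) := by
  have hγ := isWhiteNoise_complexGaussian 1
  refine klDiv_map_conv_eq_snrDiv ν (e := ((WithLp.addEquiv 2 (ℂ × ℂ)).symm : ℂ × ℂ →+ _))
    (WithLp.measurable_toLp 2 _) (WithLp.measurable_ofLp 2 _) (fun _ => rfl) (hγ.prod hγ)
    (by fun_prop) (a := WithLp.toLp 2 ((Real.sqrt x : ℂ), (Real.sqrt y : ℂ))) (fun _ => rfl) ?_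
  simp only [WithLp.prod_norm_sq_eq_of_L2, WithLp.toLp_fst, WithLp.toLp_snd, sq_norm_ofReal_sqrt,
    NNReal.coe_add]

lemma klDiv_triple_conv (x y z : ℝ≥0) :
    klDiv (ν.map (fun u : ℂ => ((u * Real.sqrt x, u * Real.sqrt y), u * Real.sqrt z))
        ∗ ((complexGaussian 1).prod (complexGaussian 1)).prod (complexGaussian 1))
      (((complexGaussian 1).prod (complexGaussian 1)).prod (complexGaussian 1))
      = snrDiv ν (x + y + z) := by
  have hγ := isWhiteNoise_complexGaussian 1
  let e : (ℂ × ℂ) × ℂ →+ WithLp 2 (WithLp 2 (ℂ × ℂ) × ℂ) :=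
    ((WithLp.addEquiv 2 (WithLp 2 (ℂ × ℂ) × ℂ)).symm : _ →+ _).comp
      (((WithLp.addEquiv 2 (ℂ × ℂ)).symm : ℂ × ℂ →+ WithLp 2 (ℂ × ℂ)).prodMap (AddMonoidHom.id ℂ))
  have hinner : Measurable (Prod.map (WithLp.toLp 2) id :
      (ℂ × ℂ) × ℂ → WithLp 2 (ℂ × ℂ) × ℂ) :=
    (WithLp.measurable_toLp 2 _).prodMap measurable_id
  have he : Measurable e := (WithLp.measurable_toLp 2 _).comp hinner
  have hnoise : IsWhiteNoise
      ((((complexGaussian 1).prod (complexGaussian 1)).prod (complexGaussian 1)).map e) 1 := by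
    have h := (hγ.prod hγ).prod hγ
    nth_rw 3 [← Measure.map_id (μ := complexGaussian 1)] at h
    rwa [Measure.map_prod_map _ _ (WithLp.measurable_toLp 2 _) measurable_id,
      Measure.map_map (WithLp.measurable_toLp 2 _) hinner] at h
  refine klDiv_map_conv_eq_snrDiv ν (e := e) he
    (d := fun p => (WithLp.ofLp p.fst, p.snd)) (by fun_prop) (fun _ => rfl) hnoise
    (by fun_prop) (a := WithLp.toLp 2 (WithLp.toLp 2 ((Real.sqrt x : ℂ), (Real.sqrt y : ℂ)),
      (Real.sqrt z : ℂ))) (fun _ => rfl) ?_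
  simp only [WithLp.prod_norm_sq_eq_of_L2, WithLp.toLp_fst, WithLp.toLp_snd, sq_norm_ofReal_sqrt,
    NNReal.coe_add]

lemma snrDiv_supermodular (r h k : ℝ≥0) :
    snrDiv ν (r + h) + snrDiv ν (r + k) ≤ snrDiv ν (r + h + k) + snrDiv ν r := by
  let γ := complexGaussian 1
  let s (ρ : ℝ≥0) (u : ℂ) : ℂ := u * Real.sqrt ρ
  let σ := ν.map fun u => ((s r u, s h u), s k u)
  have : IsProbabilityMeasure σ := Measure.isProbabilityMeasure_map (by fun_prop)
  have hfst : σ.fst = ν.map fun u => (s r u, s h u) :=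
    Measure.map_map measurable_fst (by fun_prop)
  have hfst_fst : σ.fst.fst = ν.map ((Real.sqrt r : ℂ) * ·) := by
    rw [hfst, Measure.fst_map_prodMk (by fun_prop)]
    simp only [s, mul_comm]
  have hdrop : Measurable (Prod.map Prod.fst id : (ℂ × ℂ) × ℂ → ℂ × ℂ) := by fun_prop
  have hnoise : ((γ.prod γ).prod γ).map (Prod.map Prod.fst id) = γ.prod γ := by
    have hsplit := Measure.map_prod_map (γ.prod γ) γ (f := Prod.fst) measurable_fst measurable_id
    rw [← hsplit, Measure.map_id]
    exact congrArg (Measure.prod · γ) Measure.fst_prod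
  have hsk : (σ ∗ (γ.prod γ).prod γ).map (Prod.map Prod.fst id)
      = ν.map (fun u => (s r u, s k u)) ∗ γ.prod γ := by
    have hconv := Measure.map_conv_addMonoidHom (μ := σ) (ν := (γ.prod γ).prod γ)
      ((AddMonoidHom.fst ℂ ℂ).prodMap (AddMonoidHom.id ℂ)) hdrop
    rw [AddMonoidHom.coe_prodMap] at hconv
    exact hconv.trans (congrArg₂ _ (Measure.map_map hdrop (by fun_prop)) hnoise)
  have hsuper := klDiv_supermodular (σ ∗ (γ.prod γ).prod γ) γ γ γ
  rwa [fst_conv, fst_conv, Measure.fst_prod, Measure.fst_prod, hfst_fst, hfst, hsk, klDiv_pair_conv,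
    klDiv_pair_conv, klDiv_triple_conv] at hsuper

lemma toReal_snrInfo_add_toReal_snrDiv (hν : ∫ u, ‖u‖ ^ 2 ∂ν = 1) (ρ : ℝ≥0) :
    (snrInfo ν ρ).toReal + (snrDiv ν ρ).toReal = ρ := by
  rw [← ENNReal.toReal_add (snrInfo_ne_top ν hν ρ) (snrDiv_ne_top ν hν ρ),
    snrInfo_add_snrDiv ν hν, ENNReal.coe_toReal]

end ScalarChannel

section Convexity

/-- At the leftmost point where the maximum over `[0, 1]` is attained, midpoint convexity fails if
this maximum is positive. -/
lemma nonpos_of_midpoint_convex {g : ℝ → ℝ} (hg : ContinuousOn g (Set.Icc 0 1)) (h0 : g 0 ≤ 0)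
    (h1 : g 1 ≤ 0)
    (hmid : ∀ x ∈ Set.Icc (0 : ℝ) 1, ∀ y ∈ Set.Icc (0 : ℝ) 1,
      g (midpoint ℝ x y) ≤ (g x + g y) / 2) {t : ℝ} (ht : t ∈ Set.Icc (0 : ℝ) 1) : g t ≤ 0 := by
  obtain ⟨m, hm, hmax⟩ := isCompact_Icc.exists_isMaxOn ⟨t, ht⟩ hg
  have hargmax : IsCompact (Set.Icc 0 1 ∩ g ⁻¹' {g m}) :=
    isCompact_Icc.of_isClosed_subset
      (hg.preimage_isClosed_of_isClosed isClosed_Icc isClosed_singleton) Set.inter_subset_left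
  obtain ⟨c, ⟨hc, hcm : g c = g m⟩, hleast⟩ := hargmax.exists_isLeast ⟨m, hm, rfl⟩
  by_contra! htpos
  have hcpos : 0 < g c := hcm ▸ htpos.trans_le (hmax ht)
  have hc0 : 0 < c := hc.1.lt_of_ne fun h => by rw [← h] at hcpos; linarith
  have hc1 : c < 1 := hc.2.lt_of_ne fun h => by rw [h] at hcpos; linarith
  obtain ⟨δ, hδ, hδ'⟩ := exists_between (lt_min hc0 (sub_pos.2 hc1))
  have hδc := hδ'.trans_le (min_le_left _ _)
  have hδc1 := hδ'.trans_le (min_le_right _ _)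
  have hleft : c - δ ∈ Set.Icc (0 : ℝ) 1 := ⟨by linarith, by linarith⟩
  have hright : c + δ ∈ Set.Icc (0 : ℝ) 1 := ⟨by linarith, by linarith⟩
  have hlt : g (c - δ) < g m := (hmax hleft).lt_of_ne fun h => by
    have := hleast ⟨hleft, h⟩
    linarith
  have hle : g (c + δ) ≤ g m := hmax hright
  have := hmid _ hleft _ hright
  rw [midpoint_sub_add, hcm] at this
  linarith

lemma convexOn_of_midpoint {E : Type*} [AddCommGroup E] [Module ℝ E] [TopologicalSpace E]
    [IsTopologicalAddGroup E] [ContinuousSMul ℝ E] {S : Set E} {f : E → ℝ} (hS : Convex ℝ S)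
    (hf : ContinuousOn f S)
    (hmid : ∀ x ∈ S, ∀ y ∈ S, f (midpoint ℝ x y) ≤ (f x + f y) / 2) : ConvexOn ℝ S f := by
  refine ⟨hS, fun x hx y hy a b ha hb hab => ?_⟩
  set L := AffineMap.lineMap (k := ℝ) x y
  have hL : Set.MapsTo L (Set.Icc 0 1) S := fun t ht => hS.lineMap_mem hx hy ht
  have hLcont : Continuous L := by fun_prop
  have hchord : f (L b) - ((1 - b) * f x + b * f y) ≤ 0 := by
    refine nonpos_of_midpoint_convex (g := fun t => f (L t) - ((1 - t) * f x + t * f y))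
      (.sub (hf.comp hLcont.continuousOn hL) (by fun_prop)) ?_ ?_ ?_ ⟨hb, by linarith⟩
    · simp [L]
    · simp [L]
    · intro s hs t ht
      have h := hmid _ (hL hs) _ (hL ht)
      rw [← L.map_midpoint] at h
      have hst : midpoint ℝ s t = (s + t) / 2 := by
        rw [midpoint_eq_smul_add, invOf_eq_inv, smul_eq_mul, inv_mul_eq_div]
      linear_combination h - (f y - f x) * hst
  have hLb : L b = a • x + b • y := by
    rw [AffineMap.lineMap_apply_module, ← eq_sub_of_add_eq hab]
  rw [hLb, ← eq_sub_of_add_eq hab] at hchord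
  simpa only [smul_eq_mul, sub_nonpos] using hchord

lemma exists_supporting_line {S : Set ℝ} {f : ℝ → ℝ} (hf : ConvexOn ℝ S f) {c : ℝ}
    (hc : c ∈ interior S) : ∃ s : ℝ, ∀ r ∈ S, f c + s * (r - c) ≤ f r := by
  refine ⟨derivWithin f (Set.Ioi c) c, fun r hr => ?_⟩
  rcases lt_trichotomy r c with hlt | rfl | hgt
  · have h := (hf.slope_le_leftDeriv_of_mem_interior hr hc hlt).trans
      (hf.leftDeriv_le_rightDeriv_of_mem_interior hc)
    rw [slope_def_field, div_le_iff₀ (sub_pos.2 hlt)] at h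
    linarith
  · simp
  · have h := hf.rightDeriv_le_slope_of_mem_interior hc hr hgt
    rw [slope_def_field, le_div_iff₀ (sub_pos.2 hgt)] at h
    linarith

end Convexity

section ScalarChannelConcavity

variable (ν : Measure ℂ) [IsProbabilityMeasure ν]

lemma snrDiv_zero : snrDiv ν 0 = 0 := by
  simp [snrDiv]

lemma snrDiv_mono : Monotone (snrDiv ν) := by
  intro x y hxy
  have h := snrDiv_supermodular ν 0 x (y - x)
  rw [zero_add, zero_add, add_tsub_cancel_of_le hxy, snrDiv_zero, add_zero] at h
  exact le_self_add.trans h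

variable (hν : ∫ u, ‖u‖ ^ 2 ∂ν = 1)
include hν

lemma lipschitzWith_toReal_snrDiv : LipschitzWith 1 fun ρ : ℝ≥0 => (snrDiv ν ρ).toReal := by
  refine LipschitzWith.of_le_add fun x y => ?_
  rcases le_total x y with h | h
  · have := ENNReal.toReal_mono (snrDiv_ne_top ν hν y) (snrDiv_mono ν h)
    exact this.trans (le_add_of_nonneg_right dist_nonneg)
  · have hI := ENNReal.toReal_mono (snrInfo_ne_top ν hν x) (snrInfo_mono ν h)
    have hx := toReal_snrInfo_add_toReal_snrDiv ν hν x
    have hy := toReal_snrInfo_add_toReal_snrDiv ν hν y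
    have hdist : (x : ℝ) - y ≤ dist x y := le_abs_self _
    linarith

lemma convexOn_toReal_snrDiv :
    ConvexOn ℝ (Set.Ici 0) fun t : ℝ => (snrDiv ν t.toNNReal).toReal := by
  refine convexOn_of_midpoint (convex_Ici 0) (Continuous.continuousOn
    ((lipschitzWith_toReal_snrDiv ν hν).continuous.comp continuous_real_toNNReal)) ?_
  intro x hx y hy
  wlog hxy : x ≤ y generalizing x y
  · rw [midpoint_comm, add_comm]
    exact this y hy x hx (le_of_not_ge hxy)
  lift x to ℝ≥0 using hx
  lift y to ℝ≥0 using hy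
  obtain ⟨h, rfl⟩ : ∃ h : ℝ≥0, y = x + h + h :=
    ⟨(y - x) / 2, by rw [add_assoc, add_halves, add_tsub_cancel_of_le (mod_cast hxy)]⟩
  have hmid : midpoint ℝ (x : ℝ) ((x + h + h : ℝ≥0) : ℝ) = ((x + h : ℝ≥0) : ℝ) := by
    rw [midpoint_eq_smul_add, invOf_eq_inv, smul_eq_mul]
    push_cast
    ring
  have hne := fun ρ => snrDiv_ne_top ν hν ρ
  have hsuper := ENNReal.toReal_mono (ENNReal.add_ne_top.2 ⟨hne _, hne _⟩)
    (snrDiv_supermodular ν x h h)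
  rw [ENNReal.toReal_add (hne _) (hne _), ENNReal.toReal_add (hne _) (hne _)] at hsuper
  simp only [hmid, Real.toNNReal_coe]
  linarith

lemma exists_snrInfo_supporting_line (c : ℝ≥0) :
    ∃ s : ℝ, ∀ r : ℝ≥0, (snrInfo ν r).toReal ≤ (snrInfo ν c).toReal + s * (r - c) := by
  have hbudget := toReal_snrInfo_add_toReal_snrDiv ν hν
  rcases eq_zero_or_pos c with rfl | hc
  · refine ⟨1, fun r => ?_⟩
    have hdiv : 0 ≤ (snrDiv ν r).toReal := ENNReal.toReal_nonneg
    rw [snrInfo_zero, ENNReal.toReal_zero, NNReal.coe_zero]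
    linarith [hbudget r]
  have hc' : (c : ℝ) ∈ interior (Set.Ici 0) := by
    rw [interior_Ici]
    exact NNReal.coe_pos.2 hc
  obtain ⟨s, hs⟩ := exists_supporting_line (convexOn_toReal_snrDiv ν hν) hc'
  refine ⟨1 - s, fun r => ?_⟩
  have h := hs r r.coe_nonneg
  simp only [Real.toNNReal_coe] at h
  linarith [hbudget r, hbudget c]

end ScalarChannelConcavity

/-! ### Superposition of two signals and the Alamouti scheme -/

section Superposition

lemma nnnorm_sq_ofReal_sqrt (p : ℝ≥0) : ‖(Real.sqrt p : ℂ)‖₊ ^ 2 = p :=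
  NNReal.coe_injective (sq_norm_ofReal_sqrt p)

lemma nnnorm_sq_gain (γ θ : ℝ) :
    ‖(γ : ℂ) * Complex.exp ((θ : ℂ) * Complex.I)‖₊ ^ 2 = Real.toNNReal (γ ^ 2) :=
  NNReal.coe_injective <| by
    rw [NNReal.coe_pow, coe_nnnorm, norm_mul, Complex.norm_exp_ofReal_mul_I, mul_one,
      Complex.norm_real, Real.norm_eq_abs, sq_abs, Real.coe_toNNReal _ (sq_nonneg γ)]

lemma map_fst_add_mul_snd (σ σ' : Measure ℂ) [SFinite σ] [SFinite σ'] (g : ℂ) :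
    (σ.prod σ').map (fun s => s.1 + g * s.2) = σ ∗ σ'.map (g * ·) := by
  rw [Measure.conv]
  nth_rw 2 [← Measure.map_id (μ := σ)]
  rw [Measure.map_prod_map _ _ (by fun_prop) (by fun_prop),
    Measure.map_map (by fun_prop) (by fun_prop)]
  rfl

lemma independentRate_eq (γ θ : ℝ) (P N : ℝ≥0) (ν : Measure ℂ) [IsProbabilityMeasure ν] :
    independentRate γ θ P N ν
      = additiveNoiseInfo (ν.map ((Real.sqrt P : ℂ) * ·)
          ∗ (ν.map ((Real.sqrt P : ℂ) * ·)).map ((γ * Complex.exp ((θ : ℂ) * Complex.I)) * ·))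
          (complexGaussian N) / ENNReal.ofReal (Real.log 2) := by
  have h := mutualInfoBits_add_noise (ν.prod ν) (complexGaussian N)
    (x := Prod.map ((Real.sqrt P : ℂ) * ·) ((Real.sqrt P : ℂ) * ·)) (by fun_prop)
    (f := fun s => s.1 + γ * Complex.exp ((θ : ℂ) * Complex.I) * s.2) (by fun_prop)
  rw [← Measure.map_prod_map _ _ (by fun_prop) (by fun_prop), map_fst_add_mul_snd] at h
  exact h

end Superposition

section GaussianInput

lemma snrDiv_complexGaussian (ρ : ℝ≥0) :
    snrDiv (complexGaussian 1) ρ = ENNReal.ofReal (ρ - Real.log (1 + ρ)) := by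
  rw [snrDiv, complexGaussian_map_mul_left, complexGaussian_conv, nnnorm_sq_ofReal_sqrt, mul_one,
    klDiv_complexGaussian (by positivity) one_ne_zero]
  push_cast
  ring_nf

lemma snrInfo_complexGaussian (ρ : ℝ≥0) :
    snrInfo (complexGaussian 1) ρ = ENNReal.ofReal (Real.log (1 + ρ)) := by
  have hpower : ∫ u, ‖u‖ ^ 2 ∂complexGaussian 1 = 1 := by
    rw [integral_sq_norm_complexGaussian, NNReal.coe_one]
  have hlog : 0 ≤ Real.log (1 + ρ) := Real.log_nonneg (by simp)
  have hlog_le : Real.log (1 + ρ) ≤ ρ := by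
    linarith [Real.log_le_sub_one_of_pos (x := 1 + ρ) (by positivity)]
  have hsum := snrInfo_add_snrDiv (complexGaussian 1) hpower ρ
  rw [← ENNReal.add_left_inj (snrDiv_ne_top _ hpower ρ), hsum, snrDiv_complexGaussian,
    ← ENNReal.ofReal_add hlog (sub_nonneg.2 hlog_le), add_sub_cancel, ENNReal.ofReal_coe_nnreal]

lemma additiveNoiseInfo_conv_complexGaussian (a b : ℂ) {v : ℝ≥0} (hv : v ≠ 0) :
    additiveNoiseInfo ((complexGaussian 1).map (a * ·) ∗ (complexGaussian 1).map (b * ·))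
        (complexGaussian v)
      = snrInfo (complexGaussian 1) ((‖a‖₊ ^ 2 + ‖b‖₊ ^ 2) / v) := by
  rw [← nnnorm_sq_ofReal_sqrt (‖a‖₊ ^ 2 + ‖b‖₊ ^ 2), ← additiveNoiseInfo_map_mul _ _ hv]
  simp only [complexGaussian_map_mul_left, complexGaussian_conv, nnnorm_sq_ofReal_sqrt, mul_one]

lemma independentRate_complexGaussian (γ θ : ℝ) (P : ℝ≥0) {N : ℝ≥0} (hN : N ≠ 0) :
    independentRate γ θ P N (complexGaussian 1)
      = scalarRate (complexGaussian 1) ((1 + Real.toNNReal (γ ^ 2)) * (P / N)) := by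
  rw [independentRate_eq, scalarRate_eq, Measure.map_map (by fun_prop) (by fun_prop)]
  have h := additiveNoiseInfo_conv_complexGaussian (Real.sqrt P)
    (γ * Complex.exp ((θ : ℂ) * Complex.I) * Real.sqrt P) hN
  rw [nnnorm_mul, mul_pow, nnnorm_sq_gain, nnnorm_sq_ofReal_sqrt, ← one_add_mul, mul_div_assoc] at h
  rw [← h]
  simp only [Function.comp_def, mul_assoc]

lemma scalarRate_complexGaussian (ρ : ℝ≥0) :
    scalarRate (complexGaussian 1) ρ = ENNReal.ofReal (Real.logb 2 (1 + ρ)) := by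
  rw [scalarRate_eq, snrInfo_complexGaussian, Real.logb,
    ENNReal.ofReal_div_of_pos (Real.log_pos one_lt_two)]

end GaussianInput

section Alamouti

/-- The two noiseless samples of an Alamouti block carrying the symbols `x.1` and `x.2` over a
channel of relative gain `g`. -/
def alamoutiSignal (g : ℂ) : ℂ × ℂ →ₗ[ℝ] ℂ × ℂ where
  toFun x := (x.1 + g * x.2, starRingEnd ℂ x.2 + g * -starRingEnd ℂ x.1)
  map_add' x y := by
    ext1 <;> simp only [Prod.fst_add, Prod.snd_add, map_add] <;> ring
  map_smul' r x := by
    ext1 <;> simp [mul_left_comm]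

lemma sq_norm_alamoutiSignal (g : ℂ) (x : ℂ × ℂ) :
    ‖(alamoutiSignal g x).1‖ ^ 2 + ‖(alamoutiSignal g x).2‖ ^ 2
      = (1 + ‖g‖ ^ 2) * (‖x.1‖ ^ 2 + ‖x.2‖ ^ 2) := by
  simp only [alamoutiSignal, LinearMap.coe_mk, AddHom.coe_mk, Complex.sq_norm,
    Complex.normSq_apply, Complex.add_re, Complex.add_im, Complex.mul_re, Complex.mul_im,
    Complex.neg_re, Complex.neg_im, Complex.conj_re, Complex.conj_im]
  ring

lemma measurable_alamoutiSignal (g : ℂ) : Measurable (alamoutiSignal g) := by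
  simp only [alamoutiSignal, LinearMap.coe_mk, AddHom.coe_mk]
  fun_prop

lemma exists_linearIsometry_alamoutiSignal (g : ℂ) :
    ∃ j : WithLp 2 (ℂ × ℂ) →ₗᵢ[ℝ] WithLp 2 (ℂ × ℂ), ∀ x,
      j (WithLp.toLp 2 (Real.sqrt (1 + ‖g‖ ^ 2) • x)) = WithLp.toLp 2 (alamoutiSignal g x) := by
  set c := Real.sqrt (1 + ‖g‖ ^ 2)
  have hc : c ^ 2 = 1 + ‖g‖ ^ 2 := Real.sq_sqrt (by positivity)
  have hc0 : c ≠ 0 := (Real.sqrt_pos.2 (by positivity)).ne'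
  refine ⟨⟨c⁻¹ • ((WithLp.linearEquiv 2 ℝ (ℂ × ℂ)).symm.toLinearMap ∘ₗ alamoutiSignal g ∘ₗ
    (WithLp.linearEquiv 2 ℝ (ℂ × ℂ)).toLinearMap), fun x => ?_⟩, fun x => ?_⟩
  · rw [← sq_eq_sq₀ (norm_nonneg _) (norm_nonneg _), LinearMap.smul_apply, norm_smul, mul_pow,
      WithLp.prod_norm_sq_eq_of_L2, WithLp.prod_norm_sq_eq_of_L2]
    have h := sq_norm_alamoutiSignal g (WithLp.ofLp x)
    rw [← hc] at h
    rw [norm_inv, inv_pow, Real.norm_eq_abs, sq_abs, inv_mul_eq_iff_eq_mul₀ (pow_ne_zero 2 hc0)]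
    exact h
  · change c⁻¹ • WithLp.toLp 2 (alamoutiSignal g (c • x)) = _
    rw [map_smul, WithLp.toLp_smul, inv_smul_smul₀ hc0]

lemma additiveNoiseInfo_map_alamoutiSignal (g : ℂ) (σ : Measure (ℂ × ℂ)) [IsProbabilityMeasure σ]
    (v : ℝ≥0) :
    additiveNoiseInfo (σ.map (alamoutiSignal g)) ((complexGaussian v).prod (complexGaussian v))
      = additiveNoiseInfo (σ.map (Real.sqrt (1 + ‖g‖ ^ 2) • ·))
          ((complexGaussian v).prod (complexGaussian v)) := by
  obtain ⟨j, hj⟩ := exists_linearIsometry_alamoutiSignal g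
  have hW := WithLp.measurable_toLp 2 (ℂ × ℂ)
  have hwhite := (isWhiteNoise_complexGaussian v).prod (isWhiteNoise_complexGaussian v)
  have := Measure.isProbabilityMeasure_map (μ := (complexGaussian v).prod (complexGaussian v))
    hW.aemeasurable
  have := Measure.isProbabilityMeasure_map (μ := σ) (measurable_alamoutiSignal g).aemeasurable
  have hscale : Measurable fun x : ℂ × ℂ => Real.sqrt (1 + ‖g‖ ^ 2) • x := by fun_prop
  have := Measure.isProbabilityMeasure_map (μ := σ) hscale.aemeasurable
  have := Measure.isProbabilityMeasure_map
    (μ := σ.map fun x => Real.sqrt (1 + ‖g‖ ^ 2) • x) hW.aemeasurable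
  have hmap : (σ.map (alamoutiSignal g)).map (WithLp.toLp 2)
      = ((σ.map (Real.sqrt (1 + ‖g‖ ^ 2) • ·)).map (WithLp.toLp 2)).map j := by
    rw [Measure.map_map hW (measurable_alamoutiSignal g), Measure.map_map hW hscale,
      Measure.map_map j.continuous.measurable (hW.comp hscale)]
    exact congrArg (σ.map ·) (funext fun x => (hj x).symm)
  rw [← additiveNoiseInfo_map_toLp 2, hmap, additiveNoiseInfo_map_linearIsometry hwhite hwhite,
    additiveNoiseInfo_map_toLp]

lemma additiveNoiseInfo_alamouti (g : ℂ) (σ σ' : Measure ℂ) [IsProbabilityMeasure σ]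
    [IsProbabilityMeasure σ'] (v : ℝ≥0) :
    additiveNoiseInfo ((σ.prod σ').map (alamoutiSignal g))
        ((complexGaussian v).prod (complexGaussian v))
      = additiveNoiseInfo (σ.map ((Real.sqrt (1 + ‖g‖ ^ 2) : ℂ) * ·)) (complexGaussian v)
        + additiveNoiseInfo (σ'.map ((Real.sqrt (1 + ‖g‖ ^ 2) : ℂ) * ·)) (complexGaussian v) := by
  set c := Real.sqrt (1 + ‖g‖ ^ 2)
  have := Measure.isProbabilityMeasure_map (μ := σ) (f := ((c : ℂ) * ·)) (by fun_prop)
  have := Measure.isProbabilityMeasure_map (μ := σ') (f := ((c : ℂ) * ·)) (by fun_prop)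
  rw [← additiveNoiseInfo_prod, Measure.map_prod_map _ _ (by fun_prop) (by fun_prop),
    additiveNoiseInfo_map_alamoutiSignal]
  rfl

lemma additiveNoiseInfo_map_conj (σ : Measure ℂ) [IsProbabilityMeasure σ] (v : ℝ≥0) :
    additiveNoiseInfo (σ.map (starRingEnd ℂ)) (complexGaussian v)
      = additiveNoiseInfo σ (complexGaussian v) :=
  additiveNoiseInfo_map_linearIsometry (isWhiteNoise_complexGaussian v)
    (isWhiteNoise_complexGaussian v) Complex.conjLIE.toLinearIsometry σ

lemma fst_map_alamoutiSignal (g : ℂ) (σ σ' : Measure ℂ) [SFinite σ] [SFinite σ'] :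
    ((σ.prod σ').map (alamoutiSignal g)).fst = σ ∗ σ'.map (g * ·) := by
  rw [Measure.fst, Measure.map_map measurable_fst (measurable_alamoutiSignal g),
    ← map_fst_add_mul_snd]
  rfl

lemma snd_map_alamoutiSignal (g : ℂ) (σ σ' : Measure ℂ) [SFinite σ] [SFinite σ'] :
    ((σ.prod σ').map (alamoutiSignal g)).snd
      = (σ' ∗ σ.map (-starRingEnd ℂ g * ·)).map (starRingEnd ℂ) := by
  rw [Measure.snd, Measure.map_map measurable_snd (measurable_alamoutiSignal g),
    ← map_fst_add_mul_snd, ← Measure.prod_swap (μ := σ), Measure.map_map (by fun_prop)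
    (by fun_prop), Measure.map_map (by fun_prop) (by fun_prop)]
  congr 1
  funext x
  simp [alamoutiSignal]

/-- The two samples of the Alamouti block are, up to a conjugation, superpositions of the
independent signals, and they carry at least the information in the block. -/
lemma additiveNoiseInfo_alamouti_le (γ : ℝ) (σ : Measure ℂ) [IsProbabilityMeasure σ]
    (hσ : σ.map (fun u => -u) = σ) (v : ℝ≥0) :
    additiveNoiseInfo (σ.map ((Real.sqrt (1 + γ ^ 2) : ℂ) * ·)) (complexGaussian v)
      ≤ additiveNoiseInfo (σ ∗ σ.map ((γ : ℂ) * ·)) (complexGaussian v) := by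
  have := Measure.isProbabilityMeasure_map (μ := σ.prod σ)
    (measurable_alamoutiSignal γ).aemeasurable
  have := Measure.isProbabilityMeasure_map (μ := σ) (f := ((γ : ℂ) * ·)) (by fun_prop)
  have hneg : σ.map (-(γ : ℂ) * ·) = σ.map ((γ : ℂ) * ·) := by
    conv_rhs => rw [← hσ, Measure.map_map (by fun_prop) (by fun_prop)]
    simp only [Function.comp_def, mul_neg, neg_mul]
  have h := additiveNoiseInfo_prod_le ((σ.prod σ).map (alamoutiSignal γ)) (complexGaussian v)
    (complexGaussian v)
  rw [additiveNoiseInfo_alamouti, fst_map_alamoutiSignal, snd_map_alamoutiSignal,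
    Complex.conj_ofReal, hneg, additiveNoiseInfo_map_conj, ← two_mul, ← two_mul,
    ENNReal.mul_le_mul_iff_right two_ne_zero ENNReal.ofNat_ne_top] at h
  simpa only [Complex.norm_real, Real.norm_eq_abs, sq_abs] using h

lemma additiveNoiseInfo_map_sqrt_mul (γ : ℝ) (P : ℝ≥0) {N : ℝ≥0} (hN : N ≠ 0) (ν : Measure ℂ)
    [IsProbabilityMeasure ν] :
    additiveNoiseInfo ((ν.map ((Real.sqrt P : ℂ) * ·)).map ((Real.sqrt (1 + γ ^ 2) : ℂ) * ·))
        (complexGaussian N)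
      = snrInfo ν ((1 + Real.toNNReal (γ ^ 2)) * (P / N)) := by
  have hc : (1 + γ ^ 2 : ℝ) = ((1 + Real.toNNReal (γ ^ 2) : ℝ≥0) : ℝ) := by
    rw [NNReal.coe_add, NNReal.coe_one, Real.coe_toNNReal _ (sq_nonneg γ)]
  rw [Measure.map_map (by fun_prop) (by fun_prop), hc, ← mul_div_assoc]
  nth_rw 2 [← nnnorm_sq_ofReal_sqrt (1 + _), ← nnnorm_sq_ofReal_sqrt P]
  rw [← mul_pow, ← nnnorm_mul, ← additiveNoiseInfo_map_mul _ _ hN]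
  simp only [Function.comp_def, mul_assoc]

lemma alamoutiRate_eq (γ θ : ℝ) (P : ℝ≥0) {N : ℝ≥0} (hN : N ≠ 0) (ν : Measure ℂ)
    [IsProbabilityMeasure ν] :
    alamoutiRate γ θ P N ν = scalarRate ν ((1 + Real.toNNReal (γ ^ 2)) * (P / N)) := by
  set g : ℂ := γ * Complex.exp ((θ : ℂ) * Complex.I)
  have hg : ‖g‖ ^ 2 = γ ^ 2 := by
    rw [norm_mul, Complex.norm_exp_ofReal_mul_I, mul_one, Complex.norm_real, Real.norm_eq_abs,
      sq_abs]
  have := Measure.isProbabilityMeasure_map (μ := ν) (f := ((Real.sqrt P : ℂ) * ·)) (by fun_prop)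
  have h := mutualInfoBits_add_noise (ν.prod ν) ((complexGaussian N).prod (complexGaussian N))
    (x := Prod.map ((Real.sqrt P : ℂ) * ·) ((Real.sqrt P : ℂ) * ·)) (by fun_prop)
    (measurable_alamoutiSignal g)
  rw [← Measure.map_prod_map _ _ (by fun_prop) (by fun_prop), additiveNoiseInfo_alamouti, hg,
    additiveNoiseInfo_map_sqrt_mul γ P hN ν, ← mul_two, ENNReal.mul_div_right_comm,
    ← scalarRate_eq] at h
  exact (congrArg (· / 2) h).trans
    (ENNReal.mul_div_cancel_right two_ne_zero ENNReal.ofNat_ne_top)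

lemma scalarRate_le_independentRate (γ : ℝ) (P : ℝ≥0) {N : ℝ≥0} (hN : N ≠ 0) (ν : Measure ℂ)
    [IsProbabilityMeasure ν] (hsymm : ν.map (fun u => -u) = ν) :
    scalarRate ν ((1 + Real.toNNReal (γ ^ 2)) * (P / N)) ≤ independentRate γ 0 P N ν := by
  have := Measure.isProbabilityMeasure_map (μ := ν) (f := ((Real.sqrt P : ℂ) * ·)) (by fun_prop)
  have hsymm' : (ν.map ((Real.sqrt P : ℂ) * ·)).map (fun u => -u)
      = ν.map ((Real.sqrt P : ℂ) * ·) := by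
    conv_rhs => rw [← hsymm, Measure.map_map (by fun_prop) (by fun_prop)]
    rw [Measure.map_map (by fun_prop) (by fun_prop)]
    simp only [Function.comp_def, mul_neg]
  rw [scalarRate_eq, independentRate_eq, ← additiveNoiseInfo_map_sqrt_mul γ P hN ν,
    Complex.ofReal_zero, zero_mul, Complex.exp_zero, mul_one]
  exact ENNReal.div_le_div_right (additiveNoiseInfo_alamouti_le γ _ hsymm' N) _

end Alamouti

/-! ### The upper bound of the pointwise ergodic theorem -/

section MaximalErgodic

variable {α : Type*}

/-- The maximum of the first `n + 1` Birkhoff sums of `g` along `T`, defined by the recursion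
`max_{k ≤ n + 1} S_k = max 0 (g + (max_{k ≤ n} S_k) ∘ T)`; it is the function of the maximal
ergodic theorem. -/
def maxBirkhoffSum (T : α → α) (g : α → ℝ) : ℕ → α → ℝ
  | 0, _ => 0
  | n + 1, x => max 0 (g x + maxBirkhoffSum T g n (T x))

section Pointwise

variable (T : α → α) (g : α → ℝ)

lemma maxBirkhoffSum_nonneg (n : ℕ) (x : α) : 0 ≤ maxBirkhoffSum T g n x := by
  cases n
  · exact le_rfl
  · exact le_max_left _ _

lemma monotone_maxBirkhoffSum (x : α) : Monotone fun n => maxBirkhoffSum T g n x := by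
  refine monotone_nat_of_le_succ fun n => ?_
  induction n generalizing x with
  | zero => exact le_max_left _ _
  | succ n ih => exact max_le_max le_rfl (by gcongr; exact ih (T x))

lemma birkhoffSum_le_maxBirkhoffSum (n : ℕ) (x : α) :
    birkhoffSum T g n x ≤ maxBirkhoffSum T g n x := by
  induction n generalizing x with
  | zero => exact (birkhoffSum_zero T g x).le
  | succ n ih =>
    rw [birkhoffSum_succ']
    exact le_max_of_le_right (by gcongr; exact ih (T x))

lemma maxBirkhoffSum_succ_sub_apply (n : ℕ) (x : α) :
    maxBirkhoffSum T g (n + 1) x - maxBirkhoffSum T g n (T x)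
      = max (-maxBirkhoffSum T g n (T x)) (g x) := by
  rw [maxBirkhoffSum, ← max_sub_sub_right, zero_sub, add_sub_cancel_right]

lemma abs_maxBirkhoffSum_succ_sub_apply_le (n : ℕ) (x : α) :
    |maxBirkhoffSum T g (n + 1) x - maxBirkhoffSum T g n (T x)| ≤ |g x| := by
  have hM := maxBirkhoffSum_nonneg T g n (T x)
  rw [maxBirkhoffSum_succ_sub_apply, abs_le]
  exact ⟨le_max_of_le_right (neg_abs_le _),
    max_le (by linarith [abs_nonneg (g x)]) (le_abs_self _)⟩

lemma bddAbove_range_maxBirkhoffSum_apply_iff (x : α) :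
    BddAbove (Set.range fun n => maxBirkhoffSum T g n (T x))
      ↔ BddAbove (Set.range fun n => maxBirkhoffSum T g n x) := by
  have hdiff := fun n => abs_le.1 (abs_maxBirkhoffSum_succ_sub_apply_le T g n x)
  simp only [bddAbove_def, Set.forall_mem_range]
  constructor
  · rintro ⟨K, hK⟩
    refine ⟨K + |g x|, fun n => ?_⟩
    linarith [monotone_maxBirkhoffSum T g x n.le_succ, hK n, (hdiff n).2]
  · rintro ⟨K, hK⟩
    exact ⟨K + |g x|, fun n => by linarith [hK (n + 1), (hdiff n).1]⟩

end Pointwise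

variable [MeasurableSpace α] {μ : Measure α} {T : α → α} {g : α → ℝ}

lemma measurable_maxBirkhoffSum (hT : Measurable T) (hg : Measurable g) (n : ℕ) :
    Measurable (maxBirkhoffSum T g n) := by
  induction n with
  | zero => exact measurable_const
  | succ n ih => exact measurable_const.max (hg.add (ih.comp hT))

lemma integrable_maxBirkhoffSum (hT : MeasurePreserving T μ μ) (hg : Integrable g μ) (n : ℕ) :
    Integrable (maxBirkhoffSum T g n) μ := by
  induction n with
  | zero => exact integrable_zero α ℝ μ
  | succ n ih => exact (integrable_zero α ℝ μ).sup (hg.add (hT.integrable_comp_of_integrable ih))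

lemma integral_maxBirkhoffSum_succ_sub_nonneg (hT : MeasurePreserving T μ μ) (hg : Measurable g)
    (hgi : Integrable g μ) (n : ℕ) :
    0 ≤ ∫ x, (maxBirkhoffSum T g (n + 1) x - maxBirkhoffSum T g n (T x)) ∂μ := by
  have hM := integrable_maxBirkhoffSum hT hgi
  have hMT : Integrable (fun x => maxBirkhoffSum T g n (T x)) μ :=
    hT.integrable_comp_of_integrable (hM n)
  have hinv : ∫ x, maxBirkhoffSum T g n (T x) ∂μ = ∫ x, maxBirkhoffSum T g n x ∂μ := by
    rw [← integral_map hT.measurable.aemeasurable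
      (measurable_maxBirkhoffSum hT.measurable hg n).aestronglyMeasurable, hT.map_eq]
  rw [integral_sub (hM (n + 1)) hMT, hinv, sub_nonneg]
  exact integral_mono (hM n) (hM (n + 1)) fun x => monotone_maxBirkhoffSum T g x n.le_succ

/-- Where the maxima diverge, `M_{n+1} - M_n ∘ T` is eventually equal to `g`. -/
lemma integral_nonneg_of_ae_not_bddAbove_maxBirkhoffSum (hT : MeasurePreserving T μ μ)
    (hg : Measurable g) (hgi : Integrable g μ)
    (hunbdd : ∀ᵐ x ∂μ, ¬BddAbove (Set.range fun n => maxBirkhoffSum T g n x)) :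
    0 ≤ ∫ x, g x ∂μ := by
  have hM := measurable_maxBirkhoffSum hT.measurable hg
  refine ge_of_tendsto' (tendsto_integral_of_dominated_convergence (fun x => |g x|)
    (fun n => ((hM (n + 1)).sub ((hM n).comp hT.measurable)).aestronglyMeasurable) hgi.abs
    (fun n => .of_forall (abs_maxBirkhoffSum_succ_sub_apply_le T g n)) ?_)
    (integral_maxBirkhoffSum_succ_sub_nonneg hT hg hgi)
  filter_upwards [hunbdd] with x hx
  rw [← bddAbove_range_maxBirkhoffSum_apply_iff] at hx
  refine tendsto_const_nhds.congr' ?_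
  filter_upwards [(tendsto_atTop_atTop_of_monotone' (monotone_maxBirkhoffSum T g (T x))
    hx).eventually_ge_atTop (-g x)] with n hn
  exact ((maxBirkhoffSum_succ_sub_apply T g n x).trans (max_eq_right (neg_le.1 hn))).symm

lemma ae_bddAbove_birkhoffSum (hT : Ergodic T μ) (hg : Measurable g) (hgi : Integrable g μ)
    (hneg : ∫ x, g x ∂μ < 0) : ∀ᵐ x ∂μ, BddAbove (Set.range fun n => birkhoffSum T g n x) := by
  have hbdd : ∀ᵐ x ∂μ, BddAbove (Set.range fun n => maxBirkhoffSum T g n x) := by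
    refine (hT.toPreErgodic.ae_mem_or_ae_notMem
      (measurableSet_bddAbove_range (measurable_maxBirkhoffSum hT.measurable hg))
      (Set.ext (bddAbove_range_maxBirkhoffSum_apply_iff T g))).resolve_right fun hunbdd => ?_
    exact hneg.not_ge (integral_nonneg_of_ae_not_bddAbove_maxBirkhoffSum hT.toMeasurePreserving
      hg hgi hunbdd)
  filter_upwards [hbdd] with x hx
  exact hx.range_mono _ fun n => birkhoffSum_le_maxBirkhoffSum T g n x

lemma ae_forall_eventually_birkhoffSum_le [IsProbabilityMeasure μ] (hT : Ergodic T μ)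
    (hg : Measurable g) (hgi : Integrable g μ) (hg0 : ∫ x, g x ∂μ ≤ 0) :
    ∀ᵐ x ∂μ, ∀ ε > 0, ∀ᶠ n : ℕ in atTop, birkhoffSum T g n x ≤ n * ε := by
  have hbdd : ∀ᵐ x ∂μ, ∀ m : ℕ, BddAbove (Set.range fun n =>
      birkhoffSum T (fun x => g x - 1 / ((m : ℝ) + 1)) n x) := by
    refine ae_all_iff.2 fun m => ae_bddAbove_birkhoffSum hT (hg.sub_const _)
      (hgi.sub (integrable_const _)) ?_
    have hm : 0 < 1 / ((m : ℝ) + 1) := Nat.one_div_pos_of_nat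
    rw [integral_sub hgi (integrable_const _), integral_const, probReal_univ, one_smul]
    linarith
  filter_upwards [hbdd] with x hx ε hε
  obtain ⟨m, hm⟩ := exists_nat_one_div_lt hε
  obtain ⟨K, hK⟩ := hx m
  have hgrow : ∀ᶠ n : ℕ in atTop, K ≤ n * (ε - 1 / ((m : ℝ) + 1)) :=
    (tendsto_natCast_atTop_atTop.atTop_mul_const (sub_pos.2 hm)).eventually_ge_atTop K
  filter_upwards [hgrow] with n hn
  have hsum := hK (Set.mem_range_self n)
  simp only [birkhoffSum, Finset.sum_sub_distrib, Finset.sum_const, Finset.card_range,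
    nsmul_eq_mul] at hsum ⊢
  linarith

end MaximalErgodic

/-! ### Energy of the symbol signatures -/

section CardinalSine

lemma integral_exp_mul_mul_I_eq_sinc (c r : ℝ) :
    ∫ t in -r..r, Complex.exp (((c * t : ℝ) : ℂ) * Complex.I)
      = 2 * r * (Real.sinc (c * r) : ℂ) := by
  rcases eq_or_ne c 0 with rfl | hc
  · simp [two_mul]
  have hscale := intervalIntegral.smul_integral_comp_mul_left (a := -r) (b := r)
    (fun t : ℝ => Complex.exp ((t : ℂ) * Complex.I)) c
  rw [mul_neg, integral_exp_mul_I_eq_sinc, Complex.real_smul, Complex.ofReal_mul] at hscale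
  refine mul_left_cancel₀ (Complex.ofReal_ne_zero.2 hc) (hscale.trans ?_)
  ring

lemma fourierCoeffOn_exp_eq_sinc (a : ℝ) (m : ℤ) :
    fourierCoeffOn (neg_lt_self Real.pi_pos)
      (fun t : ℝ => Complex.exp (((a * t : ℝ) : ℂ) * Complex.I)) m
      = (Real.sinc (Real.pi * (m - a)) : ℂ) := by
  have hexp : ∀ t : ℝ, fourier (-m) (t : AddCircle (Real.pi - -Real.pi))
      • Complex.exp (((a * t : ℝ) : ℂ) * Complex.I)
      = Complex.exp ((((a - m) * t : ℝ) : ℂ) * Complex.I) := fun t => by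
    have hπ : (Real.pi : ℂ) ≠ 0 := Complex.ofReal_ne_zero.2 Real.pi_ne_zero
    rw [fourier_coe_apply, smul_eq_mul, ← Complex.exp_add]
    congr 1
    push_cast
    field_simp
    ring
  rw [fourierCoeffOn_eq_integral]
  simp only [hexp]
  have hsymm : Real.pi * (m - a) = -((a - m) * Real.pi) := by ring
  rw [integral_exp_mul_mul_I_eq_sinc, hsymm, Real.sinc_neg, sub_neg_eq_add, ← two_mul,
    Complex.real_smul, ← mul_assoc]
  push_cast
  rw [one_div, inv_mul_cancel₀ (by simp [Real.pi_ne_zero]), one_mul]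

lemma sum_sinc_sq_le_one (a : ℝ) (s : Finset ℤ) :
    ∑ m ∈ s, Real.sinc (Real.pi * (m - a)) ^ 2 ≤ 1 := by
  have hL2 : MemLp (fun t : ℝ => Complex.exp (((a * t : ℝ) : ℂ) * Complex.I)) 2
      (volume.restrict (Set.Ioc (-Real.pi) Real.pi)) :=
    MemLp.of_bound (by fun_prop) 1 (.of_forall fun t => (Complex.norm_exp_ofReal_mul_I _).le)
  have hparseval := hasSum_sq_fourierCoeffOn (neg_lt_self Real.pi_pos) hL2
  simp only [fourierCoeffOn_exp_eq_sinc, Complex.norm_exp_ofReal_mul_I, Complex.norm_real,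
    Real.norm_eq_abs, sq_abs, one_pow, intervalIntegral.integral_const, smul_eq_mul, mul_one,
    sub_neg_eq_add] at hparseval
  rw [inv_mul_cancel₀ (by positivity)] at hparseval
  exact sum_le_hasSum s (fun _ _ => sq_nonneg _) hparseval

lemma sinc_pi_mul_intCast (m : ℤ) : Real.sinc (Real.pi * m) = if m = 0 then 1 else 0 := by
  split_ifs with hm
  · rw [hm, Int.cast_zero, mul_zero, Real.sinc_zero]
  · rw [Real.sinc_of_ne_zero (mul_ne_zero Real.pi_ne_zero (Int.cast_ne_zero.2 hm)), mul_comm,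
      Real.sin_int_mul_pi, zero_div]

end CardinalSine

section SymbolSignature

lemma sameSignalSample_eq_sum {T : ℝ} (hT : T ≠ 0) (τ γ : ℝ) (φ : ℕ → ℝ) {n : ℕ} (x : Fin n → ℂ)
    (k : ℕ) : sameSignalSample T τ γ φ x k
      = ∑ i : Fin n, impulseResponse T τ γ φ k ((k : ℤ) - (i : ℤ)) * x i := by
  rw [sameSignalSample, waveform, waveform, Finset.mul_sum, ← Finset.sum_add_distrib]
  refine Finset.sum_congr rfl fun i _ => ?_
  have hdirect : shapingPulse T (k * T - i * T)
      = if ((k : ℤ) - (i : ℤ)) = 0 then 1 else 0 := by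
    have hdelay : (k * T - i * T) / T = ((k - i : ℤ) : ℝ) := by
      push_cast
      field_simp
    rw [shapingPulse, hdelay, sinc_pi_mul_intCast]
  have hdelayed : shapingPulse T (k * T - τ - i * T)
      = Real.sinc (Real.pi * (((k - i : ℤ) : ℝ) - τ / T)) := by
    have hdelay : (k * T - τ - i * T) / T = ((k - i : ℤ) : ℝ) - τ / T := by
      push_cast
      field_simp
      ring
    rw [shapingPulse, hdelay]
  rw [hdirect, hdelayed, impulseResponse]
  split_ifs <;> push_cast <;> ring

lemma sq_norm_impulseResponse (T τ γ : ℝ) (φ : ℕ → ℝ) (k : ℕ) (m : ℤ) :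
    ‖impulseResponse T τ γ φ k m‖ ^ 2 = γ ^ 2 * Real.sinc (Real.pi * (m - τ / T)) ^ 2
      + if m = 0 then 1 + 2 * γ * Real.sinc (Real.pi * (τ / T)) * Real.cos (φ k) else 0 := by
  have hsq := Real.sin_sq_add_cos_sq (φ k)
  rw [impulseResponse, Complex.sq_norm, Complex.normSq_apply, mul_right_comm,
    ← Complex.ofReal_mul]
  simp only [Complex.add_re, Complex.add_im, Complex.re_ofReal_mul, Complex.im_ofReal_mul,
    Complex.exp_ofReal_mul_I_re, Complex.exp_ofReal_mul_I_im]
  split_ifs with hm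
  · rw [hm, Int.cast_zero, zero_sub, mul_neg, Real.sinc_neg, Complex.one_re, Complex.one_im]
    linear_combination (γ * Real.sinc (Real.pi * (τ / T))) ^ 2 * hsq
  · rw [Complex.zero_re, Complex.zero_im]
    linear_combination (γ * Real.sinc (Real.pi * (m - τ / T))) ^ 2 * hsq

/-- The contribution of a unit symbol `x_i = 1` to the `n` noiseless received samples: the `i`-th
column of the matrix of the channel. -/
noncomputable def symbolSignature (T τ γ : ℝ) (φ : ℕ → ℝ) (n : ℕ) (i : Fin n) :
    EuclideanSpace ℂ (Fin n) :=
  WithLp.toLp 2 fun k => impulseResponse T τ γ φ k ((k : ℤ) - (i : ℤ))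

/-- The delayed copy has energy at most `γ²` by Bessel's inequality, and it interferes with the
direct copy only at the sampling time of the symbol itself. -/
lemma sq_norm_symbolSignature_le (T τ γ : ℝ) (φ : ℕ → ℝ) {n : ℕ} (i : Fin n) :
    ‖symbolSignature T τ γ φ n i‖ ^ 2
      ≤ 1 + γ ^ 2 + 2 * γ * Real.sinc (Real.pi * (τ / T)) * Real.cos (φ i) := by
  have hdiag : ∀ k : Fin n, (k : ℤ) - (i : ℤ) = 0 ↔ k = i := fun k => by
    rw [sub_eq_zero, Nat.cast_inj, Fin.val_inj]
  have hinj : Function.Injective fun k : Fin n => (k : ℤ) - (i : ℤ) := fun k l hkl => by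
    simpa [Fin.val_inj] using hkl
  have hbessel := sum_sinc_sq_le_one (τ / T) (Finset.univ.map ⟨_, hinj⟩)
  rw [Finset.sum_map] at hbessel
  calc ‖symbolSignature T τ γ φ n i‖ ^ 2
      = γ ^ 2 * ∑ k : Fin n, Real.sinc (Real.pi * (((k : ℤ) - (i : ℤ) : ℤ) - τ / T)) ^ 2
        + (1 + 2 * γ * Real.sinc (Real.pi * (τ / T)) * Real.cos (φ i)) := by
        simp only [symbolSignature, EuclideanSpace.norm_sq_eq, sq_norm_impulseResponse, hdiag,
          Finset.sum_add_distrib, ← Finset.mul_sum, Finset.sum_ite_eq', Finset.mem_univ, if_true]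
    _ ≤ γ ^ 2 * 1 + (1 + 2 * γ * Real.sinc (Real.pi * (τ / T)) * Real.cos (φ i)) := by
        gcongr
        exact hbessel
    _ = _ := by ring

end SymbolSignature

/-! ### Rate with the same signal from both satellites -/

section LinearChannel

/-- A genie that removes the interference between the symbols leaves a matched filter for each of
them. -/
lemma additiveNoiseInfo_linear_le {ι κ : Type*} [Fintype ι] [Fintype κ] (ν : ι → Measure ℂ)
    [∀ i, IsProbabilityMeasure (ν i)] {v : ℝ≥0} (hv : v ≠ 0) (a : ι → EuclideanSpace ℂ κ) :
    additiveNoiseInfo ((Measure.pi ν).map fun u k => ∑ i, u i * a i k)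
        (Measure.pi fun _ => complexGaussian v)
      ≤ ∑ i, snrInfo (ν i) (‖a i‖₊ ^ 2 / v) := by
  have hsignal : (fun (u : ι → ℂ) k => ∑ i, u i * a i k)
      = ∑ i, fun (u : ι → ℂ) k => u i * a i k := by
    ext u k
    simp only [Finset.sum_apply]
  have hsymbol : ∀ i, (Measure.pi ν).map (fun u k => u i * a i k)
      = (ν i).map fun u k => u * a i k := fun i => by
    rw [← (measurePreserving_eval ν i).map_eq, Measure.map_map (by fun_prop) (by fun_prop)]
    rfl
  have hind : iIndepFun (fun i (u : ι → ℂ) k => u i * a i k) (Measure.pi ν) :=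
    iIndepFun_pi (X := fun i (x : ℂ) k => x * a i k) fun i => by fun_prop
  rw [hsignal]
  refine (additiveNoiseInfo_map_sum_le _ (fun i => by fun_prop) hind _).trans_eq ?_
  refine Finset.sum_congr rfl fun i _ => ?_
  rw [hsymbol, additiveNoiseInfo_map_mul_pi, additiveNoiseInfo_map_mul _ _ hv]
  simp only [WithLp.toLp_ofLp, Complex.nnnorm_real, nnnorm_norm]

end LinearChannel

section SameSignal

variable {T : ℝ} (hT : T ≠ 0) (τ γ : ℝ) (P : ℝ≥0) {N : ℝ≥0} (hN : N ≠ 0) (ν : Measure ℂ)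
  [IsProbabilityMeasure ν]

include hT hN in
lemma sameSignalInfo_le_sum (φ : ℕ → ℝ) (n : ℕ) :
    sameSignalInfo T τ γ P N ν φ n
      ≤ (∑ i : Fin n, snrInfo ν (‖symbolSignature T τ γ φ n i‖₊ ^ 2 * (P / N)))
        / ENNReal.ofReal (Real.log 2) := by
  have hinfo := mutualInfoBits_add_noise (Measure.pi fun _ : Fin n => ν)
    (Measure.pi fun _ : Fin n => complexGaussian N)
    (x := fun u k => (Real.sqrt P : ℂ) * u k) (by fun_prop)
    (f := fun x k => ∑ i : Fin n, impulseResponse T τ γ φ k ((k : ℤ) - (i : ℤ)) * x i)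
    (by fun_prop)
  rw [Measure.map_map (by fun_prop) (by fun_prop)] at hinfo
  have hlinear := additiveNoiseInfo_linear_le (fun _ : Fin n => ν) hN
    fun i => (Real.sqrt P : ℂ) • symbolSignature T τ γ φ n i
  have hsnr : ∀ i, ‖(Real.sqrt P : ℂ) • symbolSignature T τ γ φ n i‖₊ ^ 2 / N
      = ‖symbolSignature T τ γ φ n i‖₊ ^ 2 * (P / N) := fun i => by
    rw [nnnorm_smul, mul_pow, nnnorm_sq_ofReal_sqrt, mul_comm, mul_div_assoc]
  simp only [hsnr] at hlinear
  simp only [sameSignalInfo, sameSignalSample_eq_sum hT]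
  refine hinfo.trans_le (ENNReal.div_le_div_right (le_of_eq_of_le ?_ hlinear) _)
  congr with u k
  simp only [Function.comp_apply, symbolSignature, PiLp.smul_apply, smul_eq_mul]
  exact Finset.sum_congr rfl fun i _ => by ring

variable {ν} (hν : ∫ u, ‖u‖ ^ 2 ∂ν = 1)
include hν

lemma exists_snrInfo_symbolSignature_le (T : ℝ) (ρ : ℝ≥0) :
    ∃ s : ℝ, ∀ (φ : ℕ → ℝ) (n : ℕ) (i : Fin n),
      (snrInfo ν (‖symbolSignature T τ γ φ n i‖₊ ^ 2 * ρ)).toReal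
        ≤ (snrInfo ν ((1 + Real.toNNReal (γ ^ 2)) * ρ)).toReal + s * Real.cos (φ i) := by
  obtain ⟨s, hs⟩ := exists_snrInfo_supporting_line ν hν ((1 + Real.toNNReal (γ ^ 2)) * ρ)
  refine ⟨s * (2 * γ * Real.sinc (Real.pi * (τ / T)) * ρ), fun φ n i => ?_⟩
  set e := 1 + γ ^ 2 + 2 * γ * Real.sinc (Real.pi * (τ / T)) * Real.cos (φ i)
  have henergy := sq_norm_symbolSignature_le T τ γ φ i
  have he : 0 ≤ e := (sq_nonneg _).trans henergy
  have hmono : ‖symbolSignature T τ γ φ n i‖₊ ^ 2 * ρ ≤ e.toNNReal * ρ := by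
    gcongr
    exact NNReal.le_toNNReal_of_coe_le henergy
  calc (snrInfo ν (‖symbolSignature T τ γ φ n i‖₊ ^ 2 * ρ)).toReal
      ≤ (snrInfo ν (e.toNNReal * ρ)).toReal :=
        ENNReal.toReal_mono (snrInfo_ne_top ν hν _) (snrInfo_mono ν hmono)
    _ ≤ _ := hs _
    _ = _ := by
        push_cast
        rw [Real.coe_toNNReal _ he, Real.coe_toNNReal _ (sq_nonneg γ)]
        ring

include hT hN

/-- The concavity of `snrInfo ν` makes the interference linear in `cos (φ i)`, so that it averages
out. -/
lemma exists_sameSignalInfo_le :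
    ∃ s : ℝ, ∀ φ : ℕ → ℝ,
      (∀ i, 0 ≤ (snrInfo ν ((1 + Real.toNNReal (γ ^ 2)) * (P / N))).toReal
        + s * Real.cos (φ i)) ∧
      ∀ n : ℕ, sameSignalInfo T τ γ P N ν φ n
        ≤ ENNReal.ofReal (∑ i ∈ Finset.range n,
            ((snrInfo ν ((1 + Real.toNNReal (γ ^ 2)) * (P / N))).toReal + s * Real.cos (φ i)))
          / ENNReal.ofReal (Real.log 2) := by
  obtain ⟨s, hs⟩ := exists_snrInfo_symbolSignature_le τ γ hν T (P / N)
  refine ⟨s, fun φ => ⟨fun i => ENNReal.toReal_nonneg.trans (hs φ (i + 1) (Fin.last i)),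
    fun n => (sameSignalInfo_le_sum hT τ γ P hN ν φ n).trans ?_⟩⟩
  refine ENNReal.div_le_div_right ?_ _
  rw [← Fin.sum_univ_eq_sum_range (fun i => _ + s * Real.cos (φ i)), ENNReal.ofReal_sum_of_nonneg
    fun i _ => ENNReal.toReal_nonneg.trans (hs φ n i)]
  exact Finset.sum_le_sum fun i _ =>
    (ENNReal.le_ofReal_iff_toReal_le (snrInfo_ne_top ν hν _)
      (ENNReal.toReal_nonneg.trans (hs φ n i))).2 (hs φ n i)

end SameSignal

section StationaryErgodic

variable {Ω : Type*} [MeasurableSpace Ω] {μ : Measure Ω}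

namespace IsStationaryErgodic

variable {Z : ℕ → Ω → ℂ} (hZ : IsStationaryErgodic μ Z) (hZm : ∀ k, Measurable (Z k))

include hZ hZm

lemma identDistrib (k : ℕ) : IdentDistrib (Z k) (Z 0) μ μ := by
  refine ⟨(hZm k).aemeasurable, (hZm 0).aemeasurable, ?_⟩
  have hpath : Measurable fun ω k => Z k ω := measurable_pi_lambda _ hZm
  have hmarg : ∀ k, μ.map (Z k) = (μ.map fun ω k => Z k ω).map (Function.eval k) := fun k => by
    rw [Measure.map_map (measurable_pi_apply k) hpath]
    rfl
  induction k with
  | zero => rfl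
  | succ k ih =>
    have hshift : MeasurePreserving _ _ _ := Ergodic.toMeasurePreserving hZ
    rw [← ih, hmarg, hmarg]
    conv_rhs => rw [← hshift.map_eq, Measure.map_map (measurable_pi_apply k) hshift.measurable]
    rfl

lemma ae_forall_eventually_sum_le [IsProbabilityMeasure μ] {f : ℂ → ℝ} (hf : Measurable f)
    (hfi : Integrable (fun ω => f (Z 0 ω)) μ) (hf0 : ∫ ω, f (Z 0 ω) ∂μ ≤ 0) :
    ∀ᵐ ω ∂μ, ∀ ε > 0, ∀ᶠ n : ℕ in atTop, ∑ i ∈ Finset.range n, f (Z i ω) ≤ n * ε := by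
  have hpath : Measurable fun ω k => Z k ω := measurable_pi_lambda _ hZm
  have hf₀ : Measurable fun z : ℕ → ℂ => f (z 0) := hf.comp (measurable_pi_apply 0)
  have := Measure.isProbabilityMeasure_map (μ := μ) hpath.aemeasurable
  have hiter : ∀ i, (fun (z : ℕ → ℂ) k => z (k + 1))^[i] = fun z k => z (k + i) := fun i => by
    induction i with
    | zero => rfl
    | succ i ih =>
      rw [Function.iterate_succ, ih]
      rfl
  have hbirkhoff := ae_forall_eventually_birkhoffSum_le hZ hf₀
    ((integrable_map_measure hf₀.aestronglyMeasurable hpath.aemeasurable).2 hfi)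
    (by rwa [integral_map hpath.aemeasurable hf₀.aestronglyMeasurable])
  filter_upwards [ae_of_ae_map hpath.aemeasurable hbirkhoff] with ω hω
  simpa only [birkhoffSum, hiter, zero_add] using hω

end IsStationaryErgodic

section Phases

variable {φ : ℕ → Ω → ℝ} (hφ : ∀ k, Measurable (φ k))
  (herg : IsStationaryErgodic μ (fun k ω => Complex.exp ((φ k ω : ℂ) * Complex.I)))
  (hmean : ∫ ω, Real.cos (φ 0 ω) ∂μ = 0)

include hφ herg hmean

lemma integral_cos_phase_eq_zero (k : ℕ) : ∫ ω, Real.cos (φ k ω) ∂μ = 0 := by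
  have hre := ((herg.identDistrib (fun k => by fun_prop) k).comp Complex.measurable_re).integral_eq
  simpa only [Function.comp_apply, Complex.exp_ofReal_mul_I_re, hmean] using hre

lemma ae_forall_eventually_sum_cos_phase_le [IsProbabilityMeasure μ] (s : ℝ) :
    ∀ᵐ ω ∂μ, ∀ ε > 0, ∀ᶠ n : ℕ in atTop,
      ∑ i ∈ Finset.range n, s * Real.cos (φ i ω) ≤ n * ε := by
  have hcos : Integrable (fun ω => s * Real.cos (φ 0 ω)) μ :=
    (Integrable.of_bound (by fun_prop) 1 (.of_forall fun ω => Real.abs_cos_le_one _)).const_mul s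
  have h := herg.ae_forall_eventually_sum_le (fun k => by fun_prop) (f := fun z => s * z.re)
    (by fun_prop)
  simp only [Complex.exp_ofReal_mul_I_re] at h
  exact h hcos (by rw [integral_const_mul, hmean, mul_zero])

end Phases

end StationaryErgodic

section RatePerSymbol

lemma limsup_div_natCast_le {a : ℕ → ℝ≥0∞} {x : ℕ → ℝ} {c : ℝ} {l : ℝ≥0∞} (hl : l ≠ 0)
    (ha : ∀ n, a n ≤ ENNReal.ofReal (∑ i ∈ Finset.range n, (c + x i)) / l)
    (hx : ∀ ε > 0, ∀ᶠ n : ℕ in atTop, ∑ i ∈ Finset.range n, x i ≤ n * ε) :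
    limsup (fun n => a n / (n : ℝ≥0∞)) atTop ≤ ENNReal.ofReal c / l := by
  have hlim : Tendsto (fun ε => ENNReal.ofReal (c + ε) / l) (nhdsWithin 0 (Set.Ioi 0))
      (nhds (ENNReal.ofReal c / l)) := by
    refine ENNReal.Tendsto.div_const (ENNReal.tendsto_ofReal ?_) (.inr hl)
    exact (Continuous.tendsto' (by fun_prop) 0 c (add_zero c)).mono_left nhdsWithin_le_nhds
  refine ge_of_tendsto hlim (eventually_mem_nhdsWithin.mono fun ε hε => ?_)
  refine limsup_le_of_le (by isBoundedDefault) ?_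
  filter_upwards [hx ε hε] with n hn
  refine ENNReal.div_le_of_le_mul ((ha n).trans ?_)
  rw [← ENNReal.mul_div_right_comm, ← ENNReal.ofReal_natCast,
    ← ENNReal.ofReal_mul' (Nat.cast_nonneg n)]
  gcongr
  rw [Finset.sum_add_distrib, Finset.sum_const, Finset.card_range, nsmul_eq_mul]
  linarith

variable {Ω : Type*} [MeasurableSpace Ω] {μ : Measure Ω} [IsProbabilityMeasure μ]
  {φ : ℕ → Ω → ℝ} (hφ : ∀ k, Measurable (φ k))
  (herg : IsStationaryErgodic μ (fun k ω => Complex.exp ((φ k ω : ℂ) * Complex.I)))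
  (hmean : ∫ ω, Real.cos (φ 0 ω) ∂μ = 0)
  {T : ℝ} (hT : T ≠ 0) (τ γ : ℝ) (P : ℝ≥0) {N : ℝ≥0} (hN : N ≠ 0)
  {ν : Measure ℂ} [IsProbabilityMeasure ν] (hν : ∫ u, ‖u‖ ^ 2 ∂ν = 1)

include hφ herg hmean hT hN hν

lemma ae_limsup_sameSignalInfo_le :
    ∀ᵐ ω ∂μ,
      limsup (fun n : ℕ => sameSignalInfo T τ γ P N ν (fun l => φ l ω) n / (n : ℝ≥0∞)) atTop
        ≤ scalarRate ν ((1 + Real.toNNReal (γ ^ 2)) * (P / N)) := by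
  obtain ⟨s, hs⟩ := exists_sameSignalInfo_le hT τ γ P hN hν
  filter_upwards [ae_forall_eventually_sum_cos_phase_le hφ herg hmean s] with ω hω
  rw [scalarRate_eq, ← ENNReal.ofReal_toReal (snrInfo_ne_top ν hν _)]
  exact limsup_div_natCast_le (ENNReal.ofReal_pos.2 (Real.log_pos one_lt_two)).ne'
    (hs fun l => φ l ω).2 hω

lemma limsup_lintegral_sameSignalInfo_le :
    limsup (fun n : ℕ =>
        (∫⁻ ω, sameSignalInfo T τ γ P N ν (fun l => φ l ω) n ∂μ) / (n : ℝ≥0∞)) atTop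
      ≤ scalarRate ν ((1 + Real.toNNReal (γ ^ 2)) * (P / N)) := by
  obtain ⟨s, hs⟩ := exists_sameSignalInfo_le hT τ γ P hN hν
  rw [scalarRate_eq, ← ENNReal.ofReal_toReal (snrInfo_ne_top ν hν _)]
  set c := (snrInfo ν ((1 + Real.toNNReal (γ ^ 2)) * (P / N))).toReal
  have hlog := (ENNReal.ofReal_pos.2 (Real.log_pos one_lt_two)).ne'
  have hcos : ∀ i, Integrable (fun ω => s * Real.cos (φ i ω)) μ := fun i =>
    (Integrable.of_bound (by fun_prop) 1 (.of_forall fun ω => Real.abs_cos_le_one _)).const_mul s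
  have hterm : ∀ i, Integrable (fun ω => c + s * Real.cos (φ i ω)) μ := fun i =>
    (integrable_const c).add (hcos i)
  have hmean' : ∀ i, ∫ ω, (c + s * Real.cos (φ i ω)) ∂μ = c + 0 := fun i => by
    rw [integral_add (integrable_const c) (hcos i), integral_const, probReal_univ, one_smul,
      integral_const_mul, integral_cos_phase_eq_zero hφ herg hmean, mul_zero]
  refine limsup_div_natCast_le (x := 0) hlog (fun n => ?_) fun ε hε => .of_forall fun n => by
    simpa using by positivity
  calc ∫⁻ ω, sameSignalInfo T τ γ P N ν (fun l => φ l ω) n ∂μ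
      ≤ ∫⁻ ω, ENNReal.ofReal (∑ i ∈ Finset.range n, (c + s * Real.cos (φ i ω)))
          / ENNReal.ofReal (Real.log 2) ∂μ := lintegral_mono fun ω => (hs fun l => φ l ω).2 n
    _ = (∫⁻ ω, ENNReal.ofReal (∑ i ∈ Finset.range n, (c + s * Real.cos (φ i ω))) ∂μ)
          / ENNReal.ofReal (Real.log 2) := by
        simp only [div_eq_mul_inv]
        exact lintegral_mul_const'' _ (by fun_prop)
    _ = ENNReal.ofReal (∑ i ∈ Finset.range n, (c + (0 : ℕ → ℝ) i))
          / ENNReal.ofReal (Real.log 2) := by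
        rw [← ofReal_integral_eq_lintegral_ofReal (integrable_finsetSum _ fun i _ => hterm i)
          (.of_forall fun ω => Finset.sum_nonneg fun i _ => (hs fun l => φ l ω).1 i),
          integral_finsetSum _ fun i _ => hterm i]
        simp only [hmean', Pi.zero_apply]

end RatePerSymbol

theorem mainTheorem3 {Ω : Type*} [MeasurableSpace Ω] (μ : Measure Ω) [IsProbabilityMeasure μ]
    (φ : ℕ → Ω → ℝ) (hφ : ∀ k, Measurable (φ k))
    (herg : IsStationaryErgodic μ (fun k ω => Complex.exp ((φ k ω : ℂ) * Complex.I)))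
    (hmean : ∫ ω, Real.cos (φ 0 ω) ∂μ = 0)
    (T τ γ : ℝ) (hT : 0 < T) (P N : ℝ≥0) (hN : 0 < N)
    (ν : Measure ℂ) [IsProbabilityMeasure ν] (hν : ∫ u, ‖u‖ ^ 2 ∂ν = 1) :
    -- the channel is a time-varying frequency-selective channel
    (∀ (ω : Ω) (n : ℕ) (x : Fin n → ℂ) (k : ℕ),
      sameSignalSample T τ γ (fun l => φ l ω) x k =
        ∑ i : Fin n, impulseResponse T τ γ (fun l => φ l ω) k ((k : ℤ) - (i : ℤ)) * x i) ∧
    -- its rate per symbol, for almost every realization of the phases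
    (∀ᵐ ω ∂μ,
      limsup (fun n : ℕ => sameSignalInfo T τ γ P N ν (fun l => φ l ω) n / (n : ℝ≥0∞)) atTop
        ≤ scalarRate ν ((1 + Real.toNNReal (γ ^ 2)) * (P / N))) ∧
    -- its ergodic rate per symbol, averaged over the phases
    limsup (fun n : ℕ =>
        (∫⁻ ω, sameSignalInfo T τ γ P N ν (fun l => φ l ω) n ∂μ) / (n : ℝ≥0∞)) atTop
      ≤ scalarRate ν ((1 + Real.toNNReal (γ ^ 2)) * (P / N)) ∧
    -- the bound is the rate of the Alamouti scheme with the same input distribution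
    (∀ θ : ℝ, alamoutiRate γ θ P N ν = scalarRate ν ((1 + Real.toNNReal (γ ^ 2)) * (P / N))) ∧
    -- for symmetric inputs it is at most the rate with independent signals
    (ν.map (fun u => -u) = ν →
      scalarRate ν ((1 + Real.toNNReal (γ ^ 2)) * (P / N)) ≤ independentRate γ 0 P N ν) ∧
    -- for Gaussian inputs it is the rate with independent signals
    (ν = complexGaussian 1 →
      (∀ θ : ℝ, independentRate γ θ P N ν =
        scalarRate ν ((1 + Real.toNNReal (γ ^ 2)) * (P / N))) ∧
      scalarRate ν ((1 + Real.toNNReal (γ ^ 2)) * (P / N)) =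
        ENNReal.ofReal (Real.logb 2 (1 + (1 + γ ^ 2) * ((P : ℝ) / N)))) := by
  refine ⟨fun ω n x k => sameSignalSample_eq_sum hT.ne' τ γ _ x k,
    ae_limsup_sameSignalInfo_le hφ herg hmean hT.ne' τ γ P hN.ne' hν,
    limsup_lintegral_sameSignalInfo_le hφ herg hmean hT.ne' τ γ P hN.ne' hν,
    fun θ => alamoutiRate_eq γ θ P hN.ne' ν,
    scalarRate_le_independentRate γ P hN.ne' ν, ?_⟩
  rintro rfl
  refine ⟨fun θ => independentRate_complexGaussian γ θ P hN.ne', ?_⟩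
  rw [scalarRate_complexGaussian, NNReal.coe_mul, NNReal.coe_add, NNReal.coe_one,
    NNReal.coe_div, Real.coe_toNNReal _ (sq_nonneg γ)]
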